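/- **Conventions.** Let $q$ be a power of a prime $p$, and write $[P]=1$ if $P$ is true and $[P]=0$ otherwise. On $\mathbb{C}^{q^n}$ with orthonormal basis $|x\rangle$, $x\in\mathbb{F}_q^n$, put $X(a)|x\rangle=|x+a\rangle$ and $Z(b)|x\rangle=\omega^{\mathrm{tr}(b\cdot x)}|x\rangle$ with $\omega=e^{2\pi i/p}$ and $\mathrm{tr}$ the trace from $\mathbb{F}_q$ to $\mathbb{F}_p$, and let $G_n=\{\omega^cX(a)Z(b) : a,b\in\mathbb{F}_q^n,\ c\in\mathbb{F}_p\}$; the weight of $\omega^cX(a)Z(b)$ is the number of $i$ with $(a_i,b_i)\ne(0,0)$. The stabilizer $S$ of a nonzero subspace $Q\subseteq\mathbb{C}^{q^n}$ is the group of all $E\in G_n$ that fix every vector of $Q$, and $Q$ is a stabilizer code if it consists of all vectors fixed by $S$. The code $Q$ detects $E$ if for some scalar $\lambda_E$ one has $\langle c_1|E|c_2\rangle=\lambda_E\langle c_1|c_2\rangle$ for all $c_1,c_2\in Q$. It has minimum distance $d_Q$ if it detects all errors in $G_n$ of weight less than $d_Q$ but not some error in $G_n$ of weight $d_Q$. It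 is pure to $t$ if $S$ contains no non-scalar element of weight less than $t$, and pure if it is pure to $d_Q$. An $[[n,k,d_Q]]_q$ stabilizer code is a stabilizer code in $\mathbb{C}^{q^n}$ of dimension $q^k$ and minimum distance $d_Q$. For a prime power $r$ and $n=r^m-1$, $\mathcal{BCH}(n,r;\delta)$ denotes the primitive narrow-sense BCH code of length $n$ over $\mathbb{F}_r$ with designed distance $\delta$, that is, the cyclic code with generator polynomial $\prod_{z\in Z}(x-\alpha^z)$, where $\alpha$ is a primitive element of $\mathbb{F}_{r^m}$, $Z=C_1\cup\dots\cup C_{\delta-1}$ and $C_x=\{xr^j \bmod n : j\ge 0\}$. **Theorem.** (i) (Euclidean case.) Let $m\ge 2$ and $\delta$ be integers with $2\le\delta\le\delta_{\max}=q^{\lceil m/2\rceil}-1-(q-2)[m\text{ odd}]$. Then there exists a stabilizer code $Q$ with parameters $$[[\,q^m-1,\ q^m-1-2m\lceil(\delta-1)(1-1/q)\rceil,\ d_Q\,]]_q,\qquad d_Q\ge\delta,$$ that is pure to $\delta$, and such that, if the true minimum distance $d$ of $\mathcal{BCH}(q^m-1,q;\delta)$ satisfies $d\le\delta_{\max}$,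 then $Q$ is pure and $d_Q=d$. (ii) (Hermitian case.) Let $m\ge 1$ and $\delta$ be integers with $2\le\delta\le\delta_{\max}=q^{m+[m\text{ even}]}-1-(q^2-2)[m\text{ even}]$. Then there exists a stabilizer code $Q$ with parameters $$[[\,q^{2m}-1,\ q^{2m}-1-2m\lceil(\delta-1)(1-1/q^2)\rceil,\ d_Q\,]]_q,\qquad d_Q\ge\delta,$$ that is pure to $\delta$, and such that, if the true minimum distance $d$ of $\mathcal{BCH}(q^{2m}-1,q^2;\delta)$ satisfies $d<\delta_{\max}$, then $Q$ is pure and $d_Q=d$. -/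

import Mathlib

/-! ## Quantum stabilizer codes over a finite field `F` of characteristic `p` -/

/-- The Hilbert space `ℂ^(q^n)` of `n` qudits, with orthonormal basis `|x⟩`, `x ∈ F^n`. -/
abbrev QuditSpace (F : Type*) [Fintype F] (n : ℕ) : Type _ :=
  EuclideanSpace ℂ (Fin n → F)

/-- The element `ω^c X(a) Z(b)` of the error group `G_n`, where `ω = exp (2πi/p)`,
`X(a)|x⟩ = |x + a⟩` and `Z(b)|x⟩ = ω^(tr (b ⬝ x)) |x⟩`, with `tr` the trace from `F` to `𝔽_p`.
So it maps `|x⟩` to `ω^(c + tr (b ⬝ x)) |x + a⟩`, and the coordinate of the image of `ψ`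
at `y` is `ω^(c + tr (b ⬝ (y - a))) ψ (y - a)`.
Here `ZMod.stdAddChar j = exp (2πi j/p)`. -/
noncomputable def errorOp {p : ℕ} [Fact p.Prime] {F : Type*} [Field F] [Fintype F]
    [Algebra (ZMod p) F] {n : ℕ} (c : ZMod p) (a b : Fin n → F) :
    QuditSpace F n →ₗ[ℂ] QuditSpace F n where
  toFun ψ := WithLp.toLp 2 fun y =>
    ZMod.stdAddChar (c + Algebra.trace (ZMod p) F (b ⬝ᵥ (y - a))) * ψ (y - a)
  map_add' ψ φ := by
    ext y
    simp [mul_add]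
  map_smul' z ψ := by
    ext y
    simp [mul_left_comm]

/-- The error operators act on basis states as they should. -/
theorem errorOp_single {p : ℕ} [Fact p.Prime] {F : Type*} [Field F] [Fintype F] [DecidableEq F]
    [Algebra (ZMod p) F] {n : ℕ} (c : ZMod p) (a b x : Fin n → F) :
    errorOp c a b (EuclideanSpace.single x (1 : ℂ)) =
      (ZMod.stdAddChar (c + Algebra.trace (ZMod p) F (b ⬝ᵥ x)) : ℂ) •
        EuclideanSpace.single (x + a) (1 : ℂ) := by
  ext y
  by_cases h : y = x + a
  · subst h
    simp [errorOp]
  · have h' : y - a ≠ x := fun e => h (by rw [← e]; simp)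
    simp [errorOp, h, h']

/-- The weight of `ω^c X(a) Z(b)`: the number of positions `i` with `(a i, b i) ≠ (0, 0)`. -/
def errorWeight {F : Type*} [Field F] [DecidableEq F] {n : ℕ} (a b : Fin n → F) : ℕ :=
  (Finset.univ.filter fun i => (a i, b i) ≠ (0, 0)).card

/-- The stabilizer of `Q`: all elements of `G_n` that fix every vector of `Q`.
If `Q ≠ 0`, this is an abelian subgroup of `G_n`, and the largest one that fixes `Q` pointwise
(see `stabilizer_commute` below). -/
def stabilizer (p : ℕ) [Fact p.Prime] {F : Type*} [Field F] [Fintype F] [Algebra (ZMod p) F]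
    {n : ℕ} (Q : Submodule ℂ (QuditSpace F n)) :
    Set (QuditSpace F n →ₗ[ℂ] QuditSpace F n) :=
  {E | (∃ (c : ZMod p) (a b : Fin n → F), E = errorOp c a b) ∧ ∀ ψ ∈ Q, E ψ = ψ}

theorem errorOp_comp {p : ℕ} [Fact p.Prime] {F : Type*} [Field F] [Fintype F]
    [Algebra (ZMod p) F] {n : ℕ} (c c' : ZMod p) (a b a' b' : Fin n → F) :
    errorOp c a b ∘ₗ errorOp c' a' b' =
      errorOp (c + c' + Algebra.trace (ZMod p) F (b ⬝ᵥ a')) (a + a') (b + b') := by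
  ext ψ y
  have h1 : y - a - a' = y - (a + a') := by abel
  have h2 : (y - a) = (y - (a + a')) + a' := by abel
  simp only [errorOp, LinearMap.comp_apply, LinearMap.coe_mk, AddHom.coe_mk, h1]
  rw [← mul_assoc, ← AddChar.map_add_eq_mul]
  congr 2
  rw [h2, dotProduct_add, add_dotProduct, map_add, map_add]
  ring

/-- The elements of the stabilizer of a nonzero space commute with each other. -/
theorem stabilizer_commute {p : ℕ} [Fact p.Prime] {F : Type*} [Field F] [Fintype F]
    [Algebra (ZMod p) F] {n : ℕ} {Q : Submodule ℂ (QuditSpace F n)} (hQ : Q ≠ ⊥)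
    {E E' : QuditSpace F n →ₗ[ℂ] QuditSpace F n}
    (hE : E ∈ stabilizer p Q) (hE' : E' ∈ stabilizer p Q) : E ∘ₗ E' = E' ∘ₗ E := by
  obtain ⟨⟨c, a, b, rfl⟩, hf⟩ := hE
  obtain ⟨⟨c', a', b', rfl⟩, hf'⟩ := hE'
  obtain ⟨ψ, hψ, hne⟩ := (Submodule.ne_bot_iff Q).1 hQ
  have key : ∀ φ, errorOp c a b (errorOp c' a' b' φ) =
      (ZMod.stdAddChar (Algebra.trace (ZMod p) F (b ⬝ᵥ a') -
        Algebra.trace (ZMod p) F (b' ⬝ᵥ a)) : ℂ) • errorOp c' a' b' (errorOp c a b φ) := by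
    intro φ
    rw [← LinearMap.comp_apply, ← LinearMap.comp_apply, errorOp_comp, errorOp_comp,
      add_comm a' a, add_comm b' b]
    ext y
    simp only [errorOp, LinearMap.coe_mk, AddHom.coe_mk, PiLp.smul_apply, smul_eq_mul]
    rw [← mul_assoc, ← AddChar.map_add_eq_mul]
    congr 2
    ring
  have h1 := key ψ
  rw [hf' ψ hψ, hf ψ hψ, hf' ψ hψ] at h1
  have h2 : (ZMod.stdAddChar (Algebra.trace (ZMod p) F (b ⬝ᵥ a') -
        Algebra.trace (ZMod p) F (b' ⬝ᵥ a)) : ℂ) = 1 := by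
    have h3 : ((ZMod.stdAddChar (Algebra.trace (ZMod p) F (b ⬝ᵥ a') -
        Algebra.trace (ZMod p) F (b' ⬝ᵥ a)) : ℂ) - 1) • ψ = 0 := by
      rw [sub_smul, one_smul, ← h1, sub_self]
    rcases smul_eq_zero.1 h3 with h | h
    · exact sub_eq_zero.1 h
    · exact absurd h hne
  refine LinearMap.ext fun φ => ?_
  simpa [h2] using key φ

/-- `Q` is a stabilizer code: it is nonzero and consists of all vectors that are fixed by
every element of its stabilizer (the joint `+1` eigenspace of the stabilizer). -/
def IsStabilizerCode (p : ℕ) [Fact p.Prime] {F : Type*} [Field F] [Fintype F]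
    [Algebra (ZMod p) F] {n : ℕ} (Q : Submodule ℂ (QuditSpace F n)) : Prop :=
  Q ≠ ⊥ ∧ ∀ ψ, ψ ∈ Q ↔ ∀ E ∈ stabilizer p Q, E ψ = ψ

/-- `Q` detects the error `E`: `⟨c₁|E|c₂⟩ = λ ⟨c₁|c₂⟩` for all `c₁, c₂ ∈ Q`, for some scalar `λ`
that depends on `E` only. -/
def Detects {F : Type*} [Fintype F] {n : ℕ} (Q : Submodule ℂ (QuditSpace F n))
    (E : QuditSpace F n →ₗ[ℂ] QuditSpace F n) : Prop :=
  ∃ l : ℂ, ∀ c₁ ∈ Q, ∀ c₂ ∈ Q, inner ℂ c₁ (E c₂) = l * inner ℂ c₁ c₂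

/-- `Q` has minimum distance `d`: it detects all errors in `G_n` of weight less than `d`, but
it does not detect some error of weight `d`. -/
def HasMinDist (p : ℕ) [Fact p.Prime] {F : Type*} [Field F] [Fintype F] [DecidableEq F]
    [Algebra (ZMod p) F] {n : ℕ} (Q : Submodule ℂ (QuditSpace F n)) (d : ℕ) : Prop :=
  (∀ (c : ZMod p) (a b : Fin n → F), errorWeight a b < d → Detects Q (errorOp c a b)) ∧
  ∃ (c : ZMod p) (a b : Fin n → F), errorWeight a b = d ∧ ¬ Detects Q (errorOp c a b)

/-- `Q` is pure to `t`: its stabilizer has no non-scalar element of weight less than `t`. -/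
def IsPureTo (p : ℕ) [Fact p.Prime] {F : Type*} [Field F] [Fintype F] [DecidableEq F]
    [Algebra (ZMod p) F] {n : ℕ} (Q : Submodule ℂ (QuditSpace F n)) (t : ℕ) : Prop :=
  ∀ (c : ZMod p) (a b : Fin n → F), errorOp c a b ∈ stabilizer p Q → errorWeight a b < t →
    ∃ z : ℂ, errorOp c a b = z • (LinearMap.id : QuditSpace F n →ₗ[ℂ] QuditSpace F n)

/-- `Q` is an `[[n, k, d]]_q` stabilizer code, `q = |F|`: a stabilizer code of dimension `q^k`
in `ℂ^(q^n)` that has minimum distance `d`. -/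
def IsStabilizerCodeWith (p : ℕ) [Fact p.Prime] {F : Type*} [Field F] [Fintype F]
    [DecidableEq F] [Algebra (ZMod p) F] {n : ℕ} (Q : Submodule ℂ (QuditSpace F n))
    (k d : ℕ) : Prop :=
  IsStabilizerCode p Q ∧ Module.finrank ℂ Q = Fintype.card F ^ k ∧ HasMinDist p Q d

/-! ## Narrow-sense BCH codes -/

/-- The `q`-ary cyclotomic coset `C_x = {x q^k mod n | k ≥ 0}`. -/
def cyclotomicCoset (q n x : ℕ) : Set ℕ :=
  {y | ∃ k : ℕ, y = x * q ^ k % n}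

open Classical in
/-- The defining set `Z = C_1 ∪ ⋯ ∪ C_(δ-1)`, a set of residues in `{0, …, n-1}`. -/
noncomputable def bchDefiningSet (q n δ : ℕ) : Finset ℕ :=
  (Finset.range n).filter fun z => ∃ x, 1 ≤ x ∧ x < δ ∧ z ∈ cyclotomicCoset q n x

/-- The generator polynomial `∏_{z ∈ Z} (X - α^z)`. -/
noncomputable def bchGenerator (q n δ : ℕ) {L : Type*} [Field L] (α : L) : Polynomial L :=
  ∏ z ∈ bchDefiningSet q n δ, (Polynomial.X - Polynomial.C (α ^ z))

/-- The polynomial `c_0 + c_1 X + ⋯ + c_(n-1) X^(n-1)` of a word `c`, with coefficients in an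
extension field `L`. -/
noncomputable def wordPoly {K : Type*} [Field K] (L : Type*) [Field L] [Algebra K L] {n : ℕ}
    (c : Fin n → K) : Polynomial L :=
  ∑ i, Polynomial.C (algebraMap K L (c i)) * Polynomial.X ^ (i : ℕ)

/-- The narrow-sense BCH code of length `n` and designed distance `δ` over the finite field `K`,
formed with the element `α` (of multiplicative order `n`) of an extension field `L`: the words
over `K` whose polynomial is a multiple of the generator polynomial. -/
noncomputable def bchCode (K : Type*) [Field K] [Fintype K] {L : Type*} [Field L] [Algebra K L]
    (n δ : ℕ) (α : L) : Submodule K (Fin n → K) where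
  carrier := {c | bchGenerator (Fintype.card K) n δ α ∣ wordPoly L c}
  zero_mem' := by simp [wordPoly]
  add_mem' {c d} hc hd := by
    have h : wordPoly L (c + d) = wordPoly L c + wordPoly L d := by
      simp [wordPoly, add_mul, Finset.sum_add_distrib]
    simpa only [Set.mem_ofPred_eq, h] using dvd_add hc hd
  smul_mem' r c hc := by
    have h : wordPoly L (r • c) = Polynomial.C (algebraMap K L r) * wordPoly L c := by
      simp [wordPoly, Finset.mul_sum, mul_assoc]
    simpa only [Set.mem_ofPred_eq, h] using Dvd.dvd.mul_left hc _

/-- The linear code `C` has (true) minimum distance `d`: the least Hamming weight of a nonzero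
codeword is `d`. -/
def CodeHasMinDist {K : Type*} [Field K] [DecidableEq K] {n : ℕ} (C : Submodule K (Fin n → K))
    (d : ℕ) : Prop :=
  IsLeast {w | ∃ c ∈ C, c ≠ 0 ∧ hammingNorm c = w} d

/-! ## The bounds on the designed distance -/

/-- `q^⌈m/2⌉ - 1 - (q - 2) [m odd]` -/
noncomputable def euclidDeltaMax (q m : ℕ) : ℤ :=
  (q : ℤ) ^ ⌈(m : ℚ) / 2⌉₊ - 1 - ((q : ℤ) - 2) * (if Odd m then 1 else 0)

/-- `q^(m + [m even]) - 1 - (q^2 - 2) [m even]` -/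
def hermiteDeltaMax (q m : ℕ) : ℤ :=
  (q : ℤ) ^ (m + if Even m then 1 else 0) - 1 - ((q : ℤ) ^ 2 - 2) * (if Even m then 1 else 0)

/-!
The code `Q` comes from a totally isotropic subspace of the symplectic space `F^n × F^n`. Such a
subspace `A`, of dimension `n - k`, lifts to a group of commuting error operators whose joint fixed
space has dimension `q^k`; an error escapes detection exactly when it lies in `A^⊥` and outside
of `A` (`IsPhase.finrank_fixedSpace`, `IsPhase.not_detects`, `detects_of_notMem_symplecticDual`).
In characteristic `2` the error group contains no square root of `-1`, and the lift exists because
the subspaces below are also singular for the quadratic form `b ⬝ a` (`exists_isPhase`).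

Let `C` be the BCH code. By Delsarte's theorem it is the dual of the trace code `D`, the set of
words `i ↦ ∑ z, tr (l z * α ^ (z i))`, where `z` runs over the numbers `1, …, δ - 1` that are not
multiples of the size `r` of the field (`mem_bchCode_iff_dotProduct`). So the dimension of `D` is
at most `m * ⌈(δ - 1) * (1 - 1 / r)⌉`. As the trace is a sum of powers `y ^ (r ^ l)`, a word of `D`
vanishes at `α ^ j` unless `z * r ^ l + j` is divisible by `n` for some `z` and `l`; a word whose
entries are the `q`-th powers of those of a word in `D` satisfies the same with `z * q * r ^ l`
(`eval_pow_eq_zero_of_mem_traceCode`). The bound on `δ` is what excludes this for all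
`j = 0, …, δ_max - 1` (`not_dvd_mul_pow_add`). Hence `D`, or its conjugate in the Hermitian case,
is contained in `C`, and since it also has the zero `α ^ 0`, the BCH bound shows that its minimum
distance is larger than `δ_max`. If `d ≤ δ_max`, then a word of weight `d` in `C` lies outside of
the dual, so that purity and `d_Q = d` follow (`exists_stabilizerCode_of_le`).

The dimension of the trace code may be less than the stated number: for even `m`, the Hermitian
`δ_max` exceeds `q^m`, and there can be short cyclotomic cosets. The isotropic space is therefore
enlarged to the stated dimension in such a way that an undetected error of least weight remains
(`exists_between_finrank_eq`, `exists_isotropic_extension`). This does not affect the distance, and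
the stated `k` leaves room for it (`exists_eq_euclidDeltaMax`, `exists_eq_hermiteDeltaMax`).
-/

open Module

/-! ### Error operators -/

theorem exists_trace_mul_ne_zero (K : Type*) {L : Type*} [Field K] [Finite K] [Field L]
    [Algebra K L] [FiniteDimensional K L] {a : L} (ha : a ≠ 0) :
    ∃ b : L, Algebra.trace K L (a * b) ≠ 0 := by
  by_contra! h
  exact ha ((traceForm_nondegenerate K L).1 a h)

section ErrorOperators

variable {p : ℕ} [Fact p.Prime] {F : Type*} [Field F] [Fintype F] [Algebra (ZMod p) F] {n : ℕ}

theorem errorOp_apply (c : ZMod p) (a b : Fin n → F) (ψ : QuditSpace F n) (y : Fin n → F) :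
    errorOp c a b ψ y =
      ZMod.stdAddChar (c + Algebra.trace (ZMod p) F (b ⬝ᵥ (y - a))) * ψ (y - a) := rfl

theorem errorOp_zero (c : ZMod p) :
    errorOp c (0 : Fin n → F) 0 = (ZMod.stdAddChar c : ℂ) • LinearMap.id := by
  ext ψ y
  simp [errorOp_apply]

theorem errorOp_add_phase (c c' : ZMod p) (a b : Fin n → F) :
    errorOp (c + c') a b = (ZMod.stdAddChar c : ℂ) • errorOp c' a b := by
  ext ψ y
  simp [errorOp_apply, add_assoc, AddChar.map_add_eq_mul, mul_assoc]

/-- Error operators are unitary. -/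
theorem inner_errorOp_errorOp (c : ZMod p) (a b : Fin n → F) (ψ φ : QuditSpace F n) :
    inner ℂ (errorOp c a b ψ) (errorOp c a b φ) = inner ℂ ψ φ := by
  simp only [PiLp.inner_apply, errorOp_apply]
  rw [← Equiv.sum_comp (Equiv.subRight a) fun y => inner ℂ (ψ y) (φ y)]
  refine Finset.sum_congr rfl fun y _ => ?_
  simp only [Equiv.subRight_apply, RCLike.inner_apply, map_mul]
  set z : ℂ := ZMod.stdAddChar (c + Algebra.trace (ZMod p) F (b ⬝ᵥ (y - a))) with hz
  have h : z * (starRingEnd ℂ) z = 1 := by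
    rw [Complex.mul_conj, Complex.normSq_eq_norm_sq, hz, AddChar.norm_apply]
    simp
  linear_combination (φ (y - a) * (starRingEnd ℂ) (ψ (y - a))) * h

/-- `X(a) Z(b)` and `X(a') Z(b')` commute up to a power of `ω` that is given by the trace of the
symplectic form. -/
theorem errorOp_commute_phase (c c' : ZMod p) (a b a' b' : Fin n → F) (ψ : QuditSpace F n) :
    errorOp c a b (errorOp c' a' b' ψ) =
      (ZMod.stdAddChar (Algebra.trace (ZMod p) F (b ⬝ᵥ a' - b' ⬝ᵥ a)) : ℂ) •
        errorOp c' a' b' (errorOp c a b ψ) := by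
  rw [← LinearMap.comp_apply, ← LinearMap.comp_apply, errorOp_comp, errorOp_comp,
    ← LinearMap.smul_apply, ← errorOp_add_phase, add_comm a' a, add_comm b' b, map_sub]
  congr 2
  ring

theorem trace_errorOp_eq_zero {c : ZMod p} {a b : Fin n → F} (h : (a, b) ≠ 0) :
    LinearMap.trace ℂ _ (errorOp c a b) = 0 := by
  classical
  rw [LinearMap.trace_eq_sum_inner _ (EuclideanSpace.basisFun (Fin n → F) ℂ)]
  simp only [EuclideanSpace.basisFun_apply, errorOp_single, inner_smul_right,
    EuclideanSpace.inner_single_left, map_one, one_mul, PiLp.single_apply]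
  by_cases ha : a = 0
  · subst ha
    have hb : b ≠ 0 := fun hb => h (by simp [hb])
    -- the sum of the nontrivial character `x ↦ ω ^ tr (b ⬝ x)`
    obtain ⟨i, hi⟩ := Function.ne_iff.1 hb
    let χ : AddChar (Fin n → F) ℂ := (ZMod.stdAddChar (N := p)).compAddMonoidHom
      ((Algebra.trace (ZMod p) F).toAddMonoidHom.comp (dotProductBilin F F b).toAddMonoidHom)
    have hχ : ∀ x, χ x = ZMod.stdAddChar (Algebra.trace (ZMod p) F (b ⬝ᵥ x)) := fun x => rfl
    have hne : χ ≠ 0 := by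
      obtain ⟨y, hy⟩ := exists_trace_mul_ne_zero (ZMod p) (show b i ≠ 0 from hi)
      intro h0
      have h1 := hχ (Pi.single i y)
      rw [h0, AddChar.zero_apply, dotProduct_single, ← (ZMod.stdAddChar (N := p)).map_zero_eq_one,
        ZMod.injective_stdAddChar.eq_iff] at h1
      exact hy h1.symm
    have := AddChar.sum_eq_zero_iff_ne_zero.2 hne
    simp only [add_zero, if_true, AddChar.map_add_eq_mul, mul_one, ← hχ, ← Finset.mul_sum, this,
      mul_zero]
  · refine Finset.sum_eq_zero fun x _ => ?_
    simp [ha]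

end ErrorOperators

/-! ### The stabilizer code of a totally isotropic space -/

/-- The symplectic form `⟨(a, b), (a', b')⟩ = b ⬝ a' - b' ⬝ a` on `F^n × F^n`. -/
def symplecticForm (F : Type*) [Field F] (n : ℕ) :
    LinearMap.BilinForm F ((Fin n → F) × (Fin n → F)) :=
  LinearMap.mk₂ F (fun x y => x.2 ⬝ᵥ y.1 - y.2 ⬝ᵥ x.1)
    (fun x y z => by simp only [Prod.snd_add, Prod.fst_add, add_dotProduct, dotProduct_add]; ring)
    (fun r x y => by
      simp only [Prod.smul_snd, Prod.smul_fst, smul_dotProduct, dotProduct_smul, smul_sub])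
    (fun x y z => by simp only [Prod.snd_add, Prod.fst_add, add_dotProduct, dotProduct_add]; ring)
    (fun r x y => by
      simp only [Prod.smul_snd, Prod.smul_fst, smul_dotProduct, dotProduct_smul, smul_sub])

section Symplectic

variable {F : Type*} [Field F] {n : ℕ}

theorem symplecticForm_apply (x y : (Fin n → F) × (Fin n → F)) :
    symplecticForm F n x y = x.2 ⬝ᵥ y.1 - y.2 ⬝ᵥ x.1 := rfl

theorem symplecticForm_swap (x y : (Fin n → F) × (Fin n → F)) :
    symplecticForm F n x y = -symplecticForm F n y x := by
  simp [symplecticForm_apply]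

theorem symplecticForm_isRefl : LinearMap.IsRefl (symplecticForm F n) := fun x y h => by
  rw [symplecticForm_swap, h, neg_zero]

theorem symplecticForm_nondegenerate : (symplecticForm F n).Nondegenerate := by
  refine symplecticForm_isRefl.nondegenerate_iff_separatingLeft.2 fun x hx => ?_
  have h1 : x.2 = 0 := by
    ext i
    simpa [symplecticForm_apply] using hx (Pi.single i 1, 0)
  have h2 : x.1 = 0 := by
    ext i
    simpa [symplecticForm_apply] using hx (0, Pi.single i 1)
  exact Prod.ext h2 h1

/-- The subspace of all vectors that are symplectically orthogonal to `A`. -/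
def symplecticDual (A : Submodule F ((Fin n → F) × (Fin n → F))) :
    Submodule F ((Fin n → F) × (Fin n → F)) :=
  (symplecticForm F n).orthogonal A

theorem mem_symplecticDual {A : Submodule F ((Fin n → F) × (Fin n → F))}
    {x : (Fin n → F) × (Fin n → F)} :
    x ∈ symplecticDual A ↔ ∀ v ∈ A, v.2 ⬝ᵥ x.1 = x.2 ⬝ᵥ v.1 := by
  simp only [symplecticDual, LinearMap.BilinForm.mem_orthogonal_iff,
    symplecticForm_apply, sub_eq_zero]

theorem symplecticDual_anti {A B : Submodule F ((Fin n → F) × (Fin n → F))} (h : A ≤ B) :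
    symplecticDual B ≤ symplecticDual A :=
  LinearMap.BilinForm.orthogonal_le h

theorem finrank_symplecticDual (A : Submodule F ((Fin n → F) × (Fin n → F))) :
    finrank F (symplecticDual A) = 2 * n - finrank F A := by
  rw [symplecticDual, LinearMap.BilinForm.finrank_orthogonal symplecticForm_nondegenerate]
  simp [two_mul]

end Symplectic

section StabilizerCode

variable {p : ℕ} [Fact p.Prime] {F : Type*} [Field F] [Fintype F] [Algebra (ZMod p) F] {n : ℕ}

/-- The joint fixed space of the error operators `ω^(f v) X(a) Z(b)`, `v = (a, b) ∈ A`. -/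
def fixedSpace (A : Submodule F ((Fin n → F) × (Fin n → F)))
    (f : (Fin n → F) × (Fin n → F) → ZMod p) : Submodule ℂ (QuditSpace F n) where
  carrier := {ψ | ∀ v ∈ A, errorOp (f v) v.1 v.2 ψ = ψ}
  zero_mem' := by simp
  add_mem' hx hy v hv := by rw [map_add, hx v hv, hy v hv]
  smul_mem' z x hx v hv := by rw [map_smul, hx v hv]

/-- The condition on the exponents `f` under which `v ↦ ω^(f v) X(a) Z(b)`, `v = (a, b)`, is a
homomorphism on the additive group of `A`. -/
def IsPhase (A : Submodule F ((Fin n → F) × (Fin n → F)))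
    (f : (Fin n → F) × (Fin n → F) → ZMod p) : Prop :=
  ∀ v ∈ A, ∀ w ∈ A, f (v + w) = f v + f w + Algebra.trace (ZMod p) F (v.2 ⬝ᵥ w.1)

variable {A : Submodule F ((Fin n → F) × (Fin n → F))}
  {f : (Fin n → F) × (Fin n → F) → ZMod p}

omit [Fintype F] in
theorem IsPhase.map_zero (hf : IsPhase A f) : f 0 = 0 := by
  simpa using hf 0 A.zero_mem 0 A.zero_mem

theorem IsPhase.errorOp_errorOp (hf : IsPhase A f) {v w : (Fin n → F) × (Fin n → F)} (hv : v ∈ A)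
    (hw : w ∈ A) (ψ : QuditSpace F n) :
    errorOp (f v) v.1 v.2 (errorOp (f w) w.1 w.2 ψ) =
      errorOp (f (v + w)) (v + w).1 (v + w).2 ψ := by
  rw [← LinearMap.comp_apply, errorOp_comp, hf v hv w hw]
  rfl

open Classical in
/-- The average of the operators `ω^(f v) X(a) Z(b)`, `v = (a, b) ∈ A`. -/
noncomputable def fixedProj (A : Submodule F ((Fin n → F) × (Fin n → F)))
    (f : (Fin n → F) × (Fin n → F) → ZMod p) : QuditSpace F n →ₗ[ℂ] QuditSpace F n :=
  (Fintype.card A : ℂ)⁻¹ • ∑ v : A, errorOp (f v) v.1.1 v.1.2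

theorem IsPhase.isProj (hf : IsPhase A f) : LinearMap.IsProj (fixedSpace A f) (fixedProj A f) := by
  classical
  constructor
  · intro ψ w hw
    simp only [fixedProj, LinearMap.smul_apply, map_smul, LinearMap.sum_apply, map_sum]
    congr 1
    rw [← Equiv.sum_comp (Equiv.addLeft (⟨w, hw⟩ : A))
      fun v : A => errorOp (f v) v.1.1 v.1.2 ψ]
    refine Finset.sum_congr rfl fun v _ => ?_
    exact hf.errorOp_errorOp hw v.2 ψ
  · intro ψ hψ
    simp only [fixedProj, LinearMap.smul_apply, LinearMap.sum_apply]
    rw [Finset.sum_congr rfl fun (v : A) _ => hψ v v.2, Finset.sum_const, Finset.card_univ,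
      ← Nat.cast_smul_eq_nsmul ℂ, smul_smul, inv_mul_cancel₀, one_smul]
    exact Nat.cast_ne_zero.2 Fintype.card_ne_zero

theorem IsPhase.finrank_fixedSpace (hf : IsPhase A f) {k : ℕ} (hk : finrank F A + k = n) :
    finrank ℂ (fixedSpace A f) = Fintype.card F ^ k := by
  classical
  have h := hf.isProj.trace
  have hsum : ∑ v : A, LinearMap.trace ℂ _ (errorOp (f v) v.1.1 v.1.2) =
      (Fintype.card F : ℂ) ^ n := by
    rw [Finset.sum_eq_single (0 : A)]
    · simp [hf.map_zero, errorOp_zero]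
    · exact fun v _ hv => trace_errorOp_eq_zero (by simpa using hv)
    · simp
  have hpow : (Fintype.card F : ℂ) ^ n = Fintype.card F ^ finrank F A * Fintype.card F ^ k := by
    rw [← pow_add, hk]
  rw [fixedProj, map_smul, map_sum, hsum, smul_eq_mul, Module.card_eq_pow_finrank (K := F),
    hpow, Nat.cast_pow, inv_mul_cancel_left₀
      (pow_ne_zero _ (Nat.cast_ne_zero.2 Fintype.card_ne_zero))] at h
  exact_mod_cast h.symm

/-- `(a, b) ∉ A` makes `ω^c X(a) Z(b)` traceless on the fixed space. -/
theorem trace_errorOp_comp_fixedProj {c : ZMod p} {a b : Fin n → F} (h : (a, b) ∉ A) :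
    LinearMap.trace ℂ _ (errorOp c a b ∘ₗ fixedProj A f) = 0 := by
  classical
  rw [fixedProj, LinearMap.comp_smul, map_smul, ← Module.End.mul_eq_comp, Finset.mul_sum, map_sum,
    Finset.sum_eq_zero, smul_zero]
  intro v _
  rw [Module.End.mul_eq_comp, errorOp_comp]
  refine trace_errorOp_eq_zero fun h0 => h ?_
  have : (a, b) = -(v : (Fin n → F) × (Fin n → F)) := eq_neg_of_add_eq_zero_left h0
  rw [this]
  exact A.neg_mem v.2

/-- An error operator that acts as a scalar `l ≠ 0` on the (nonzero) fixed space comes from `A`. -/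
theorem IsPhase.mem_of_forall_eq_smul (hf : IsPhase A f) (hne : fixedSpace A f ≠ ⊥) {c : ZMod p}
    {a b : Fin n → F} {l : ℂ} (hl : l ≠ 0) (h : ∀ ψ ∈ fixedSpace A f, errorOp c a b ψ = l • ψ) :
    (a, b) ∈ A := by
  by_contra hab
  have h1 := trace_errorOp_comp_fixedProj (f := f) (c := c) hab
  have h2 : errorOp c a b ∘ₗ fixedProj A f = l • fixedProj A f :=
    LinearMap.ext fun ψ => h _ (hf.isProj.map_mem ψ)
  rw [h2, map_smul, hf.isProj.trace, smul_eq_mul, mul_eq_zero, Nat.cast_eq_zero,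
    Submodule.finrank_eq_zero] at h1
  exact h1.elim hl hne

theorem IsPhase.mem_of_mem_stabilizer (hf : IsPhase A f) (hne : fixedSpace A f ≠ ⊥) {c : ZMod p}
    {a b : Fin n → F} (h : errorOp c a b ∈ stabilizer p (fixedSpace A f)) : (a, b) ∈ A :=
  hf.mem_of_forall_eq_smul hne one_ne_zero fun ψ hψ => by rw [h.2 ψ hψ, one_smul]

theorem isStabilizerCode_fixedSpace (hne : fixedSpace A f ≠ ⊥) :
    IsStabilizerCode p (fixedSpace A f) := by
  refine ⟨hne, fun ψ => ⟨fun hψ E hE => hE.2 ψ hψ, fun h v hv => h _ ⟨⟨_, _, _, rfl⟩, ?_⟩⟩⟩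
  exact fun φ hφ => hφ v hv

/-- An error that violates the commutation with some element of the stabilizer maps the code into
an orthogonal eigenspace of that element. -/
theorem detects_of_notMem_symplecticDual {c : ZMod p} {a b : Fin n → F}
    (h : (a, b) ∉ symplecticDual A) : Detects (fixedSpace A f) (errorOp c a b) := by
  simp only [mem_symplecticDual, not_forall] at h
  obtain ⟨v, hv, hne⟩ := h
  -- scaling `v` makes the trace of the symplectic form nonzero
  obtain ⟨y, hy⟩ := exists_trace_mul_ne_zero (ZMod p) (sub_ne_zero.2 hne)
  refine ⟨0, fun c₁ h₁ c₂ h₂ => ?_⟩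
  rw [zero_mul]
  set w := y • v with hw
  have hwA : w ∈ A := A.smul_mem y hv
  have hs : Algebra.trace (ZMod p) F (w.2 ⬝ᵥ a - b ⬝ᵥ w.1) ≠ 0 := by
    convert hy using 2
    simp only [hw, Prod.smul_fst, Prod.smul_snd, smul_dotProduct, dotProduct_smul, smul_eq_mul]
    ring
  have h3 := errorOp_commute_phase (f w) c w.1 w.2 a b c₂
  rw [h₂ w hwA] at h3
  have h4 := inner_errorOp_errorOp (f w) w.1 w.2 c₁ (errorOp c a b c₂)
  rw [h₁ w hwA, h3, inner_smul_right] at h4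
  have h5 : (ZMod.stdAddChar (Algebra.trace (ZMod p) F (w.2 ⬝ᵥ a - b ⬝ᵥ w.1)) : ℂ) ≠ 1 := by
    rw [← (ZMod.stdAddChar (N := p)).map_zero_eq_one]
    exact fun h => hs (ZMod.injective_stdAddChar h)
  have h6 : ((ZMod.stdAddChar (Algebra.trace (ZMod p) F (w.2 ⬝ᵥ a - b ⬝ᵥ w.1)) : ℂ) - 1) *
      inner ℂ c₁ (errorOp c a b c₂) = 0 := by
    rw [sub_mul, h4, one_mul, sub_self]
  exact (mul_eq_zero.1 h6).resolve_left (sub_ne_zero.2 h5)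

theorem detects_of_mem {c : ZMod p} {a b : Fin n → F} (h : (a, b) ∈ A) :
    Detects (fixedSpace A f) (errorOp c a b) := by
  refine ⟨ZMod.stdAddChar (c - f (a, b)), fun c₁ _ c₂ h₂ => ?_⟩
  have h3 := h₂ _ h
  rw [← inner_smul_right]
  congr 1
  conv_rhs => rw [← h3]
  rw [← LinearMap.smul_apply, ← errorOp_add_phase, sub_add_cancel]

/-- Errors that commute with the stabilizer but do not belong to it (up to phase) act on the
code as a non-scalar, and this is not detected. -/
theorem IsPhase.not_detects (hf : IsPhase A f) (hne : fixedSpace A f ≠ ⊥) {c : ZMod p}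
    {a b : Fin n → F} (h : (a, b) ∈ symplecticDual A) (hA : (a, b) ∉ A) :
    ¬ Detects (fixedSpace A f) (errorOp c a b) := by
  rintro ⟨l, hl⟩
  have hmap : ∀ ψ ∈ fixedSpace A f, errorOp c a b ψ ∈ fixedSpace A f := by
    intro ψ hψ v hv
    have := mem_symplecticDual.1 h v hv
    rw [errorOp_commute_phase, hψ v hv, show v.2 ⬝ᵥ a - b ⬝ᵥ v.1 = 0 from sub_eq_zero.2 this]
    simp
  have heq : ∀ ψ ∈ fixedSpace A f, errorOp c a b ψ = l • ψ := by
    intro ψ hψ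
    have hmem := Submodule.sub_mem _ (hmap ψ hψ) (Submodule.smul_mem _ l hψ)
    rw [← sub_eq_zero, ← inner_self_eq_zero (𝕜 := ℂ)]
    conv_lhs => rw [inner_sub_right, inner_smul_right, hl _ hmem _ hψ, sub_self]
  refine hA (hf.mem_of_forall_eq_smul hne (c := c) (l := l) ?_ heq)
  rintro rfl
  obtain ⟨ψ, hψ, h0⟩ := (Submodule.ne_bot_iff _).1 hne
  have h1 := inner_errorOp_errorOp c a b ψ ψ
  rw [heq ψ hψ, zero_smul, inner_zero_left] at h1
  exact h0 (inner_self_eq_zero.1 h1.symm)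

end StabilizerCode

/-! ### Choice of the phases -/

/-- A symmetric alternating bilinear form is the polar form of some quadratic form: sum the
products of coordinates with indices `i < j`. -/
theorem exists_forall_add_eq_add_add {K W : Type*} [Field K] [AddCommGroup W] [Module K W]
    [FiniteDimensional K W] (β : LinearMap.BilinForm K W) (hsymm : ∀ v w, β v w = β w v)
    (halt : ∀ v, β v v = 0) : ∃ g : W → K, ∀ v w, g (v + w) = g v + g w + β v w := by
  classical
  let b := finBasis K W
  refine ⟨fun v => ∑ i, ∑ j, if i < j then b.repr v i * b.repr v j * β (b i) (b j) else 0,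
    fun v w => ?_⟩
  have hβ : β v w = ∑ i, ∑ j, b.repr v i * b.repr w j * β (b i) (b j) := by
    conv_lhs => rw [← b.sum_repr v, ← b.sum_repr w]
    simp only [map_sum, map_smul, LinearMap.sum_apply, LinearMap.smul_apply, smul_eq_mul,
      Finset.mul_sum]
    rw [Finset.sum_comm]
    exact Finset.sum_congr rfl fun i _ => Finset.sum_congr rfl fun j _ => by ring
  have hswap : (∑ i, ∑ j, if i < j then b.repr w i * b.repr v j * β (b i) (b j) else 0) =
      ∑ i, ∑ j, if j < i then b.repr v i * b.repr w j * β (b i) (b j) else 0 := by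
    rw [Finset.sum_comm]
    refine Finset.sum_congr rfl fun i _ => Finset.sum_congr rfl fun j _ => ?_
    rw [hsymm (b j), mul_comm (b.repr w j)]
  have hβ' : β v w = (∑ i, ∑ j, if i < j then b.repr v i * b.repr w j * β (b i) (b j) else 0) +
      ∑ i, ∑ j, if i < j then b.repr w i * b.repr v j * β (b i) (b j) else 0 := by
    rw [hswap, hβ, ← Finset.sum_add_distrib]
    refine Finset.sum_congr rfl fun i _ => ?_
    rw [← Finset.sum_add_distrib]
    refine Finset.sum_congr rfl fun j _ => ?_
    rcases lt_trichotomy i j with h | rfl | h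
    · simp [h, h.not_gt]
    · simp [halt]
    · simp [h, h.not_gt]
  rw [hβ']
  simp only [← Finset.sum_add_distrib]
  refine Finset.sum_congr rfl fun i _ => Finset.sum_congr rfl fun j _ => ?_
  split_ifs
  · simp only [map_add, Finsupp.add_apply]
    ring
  · simp

section Phase

variable {p : ℕ} [Fact p.Prime] {F : Type*} [Field F] [Algebra (ZMod p) F] {n : ℕ}
  {A : Submodule F ((Fin n → F) × (Fin n → F))}

/-- A totally isotropic space lifts to the error group. In characteristic `2` the square of
`X(a) Z(b)` is the scalar `(-1) ^ tr (b ⬝ a)`, so that the lift also needs `b ⬝ a = 0`. -/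
theorem exists_isPhase (hA : A ≤ symplecticDual A)
    (h2 : p = 2 → ∀ v ∈ A, v.2 ⬝ᵥ v.1 = 0) :
    ∃ f : (Fin n → F) × (Fin n → F) → ZMod p, IsPhase A f := by
  classical
  by_cases hp : p = 2
  · let β : LinearMap.BilinForm F A := LinearMap.mk₂ F (fun x y : A => x.1.2 ⬝ᵥ y.1.1)
      (fun x y z => by simp [add_dotProduct]) (fun r x y => by simp)
      (fun x y z => by simp [dotProduct_add]) (fun r x y => by simp)
    obtain ⟨g, hg⟩ := exists_forall_add_eq_add_add β
      (fun v w => mem_symplecticDual.1 (hA w.2) v v.2) (fun v => h2 hp v v.2)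
    refine ⟨fun v => if h : v ∈ A then Algebra.trace (ZMod p) F (g ⟨v, h⟩) else 0,
      fun v hv w hw => ?_⟩
    have := hg ⟨v, hv⟩ ⟨w, hw⟩
    simp only [hv, hw, A.add_mem hv hw, dif_pos]
    rw [show (⟨v + w, A.add_mem hv hw⟩ : A) = ⟨v, hv⟩ + ⟨w, hw⟩ from rfl, this, map_add, map_add]
    rfl
  · have h2' : (2 : ZMod p) ≠ 0 := by
      intro h
      have : ((2 : ℕ) : ZMod p) = 0 := by exact_mod_cast h
      rw [ZMod.natCast_eq_zero_iff] at this
      exact hp ((Nat.prime_dvd_prime_iff_eq Fact.out Nat.prime_two).1 this)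
    refine ⟨fun v => Algebra.trace (ZMod p) F (v.2 ⬝ᵥ v.1) / 2, fun v hv w hw => ?_⟩
    have h := mem_symplecticDual.1 (hA hw) v hv
    simp only [Prod.snd_add, Prod.fst_add, add_dotProduct, dotProduct_add, map_add, ← h]
    field_simp
    ring

end Phase

/-! ### Distance and purity -/

/-- The number of positions in which `x ∈ F^n × F^n` is nonzero. -/
abbrev symplecticWeight {F : Type*} [Field F] [DecidableEq F] {n : ℕ}
    (x : (Fin n → F) × (Fin n → F)) : ℕ :=
  errorWeight x.1 x.2

section Distance

variable {p : ℕ} [Fact p.Prime] {F : Type*} [Field F] [Fintype F] [DecidableEq F]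
  [Algebra (ZMod p) F] {n : ℕ}

/-- A totally isotropic space `A'` gives a stabilizer code. Its errors that escape detection are
the elements of `A'^⊥` outside of `A'`; if `A ≤ A'`, then they lie in `A^⊥` and outside of `A`.
So the distance does not change from `A` to `A'` as long as an element `c` of least weight
survives. -/
theorem exists_stabilizerCode_of_le {A A' : Submodule F ((Fin n → F) × (Fin n → F))}
    (hAA' : A ≤ A') (hA' : A' ≤ symplecticDual A')
    (h2 : p = 2 → ∀ v ∈ A', v.2 ⬝ᵥ v.1 = 0) {k : ℕ} (hk : finrank F A' + k = n)
    {c : (Fin n → F) × (Fin n → F)} (hc : c ∈ symplecticDual A') (hcA' : c ∉ A')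
    (hmin : ∀ x ∈ symplecticDual A, x ∉ A → symplecticWeight c ≤ symplecticWeight x) {δ T : ℕ}
    (hδ : ∀ x ∈ symplecticDual A, x ≠ 0 → δ ≤ symplecticWeight x)
    (hT : ∀ x ∈ A, x ≠ 0 → T < symplecticWeight x) :
    ∃ (dQ : ℕ) (Q : Submodule ℂ (QuditSpace F n)), IsStabilizerCodeWith p Q k dQ ∧
      δ ≤ dQ ∧ IsPureTo p Q δ ∧
      ∀ d, IsLeast {w | ∃ x ∈ symplecticDual A, x ≠ 0 ∧ symplecticWeight x = w} d → d ≤ T →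
        dQ = d ∧ IsPureTo p Q dQ := by
  obtain ⟨f, hf⟩ := exists_isPhase hA' h2
  have hdim := hf.finrank_fixedSpace hk
  have hne : fixedSpace A' f ≠ ⊥ := by
    intro h
    rw [h, finrank_bot] at hdim
    exact (pow_pos Fintype.card_pos k).ne hdim
  have hanti := symplecticDual_anti hAA'
  have hpure : ∀ t, (∀ x ∈ symplecticDual A, x ≠ 0 → t ≤ symplecticWeight x) →
      IsPureTo p (fixedSpace A' f) t := by
    intro t ht c₀ a b hE hw
    have hmem := hf.mem_of_mem_stabilizer hne hE
    have h0 : (a, b) = 0 := by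
      by_contra h0
      exact (ht _ (hanti (hA' hmem)) h0).not_gt hw
    obtain ⟨rfl, rfl⟩ := Prod.mk_eq_zero.1 h0
    exact ⟨_, errorOp_zero c₀⟩
  have hc0 : c ≠ 0 := fun h => hcA' (h ▸ A'.zero_mem)
  refine ⟨symplecticWeight c, fixedSpace A' f, ⟨isStabilizerCode_fixedSpace hne, hdim, ?_, ?_⟩,
    hδ c (hanti hc) hc0, hpure δ hδ, ?_⟩
  · intro c₀ a b hw
    by_cases hab : (a, b) ∈ A'
    · exact detects_of_mem hab
    · refine detects_of_notMem_symplecticDual fun hab' => ?_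
      exact (hmin _ (hanti hab') fun h => hab (hAA' h)).not_gt hw
  · exact ⟨0, c.1, c.2, rfl, hf.not_detects hne hc hcA'⟩
  · rintro d ⟨⟨x, hx, hx0, rfl⟩, hd⟩ hdT
    have hxA : x ∉ A := fun h => (hT x h hx0).not_ge hdT
    have heq : symplecticWeight c = symplecticWeight x :=
      (hmin x hx hxA).antisymm (hd ⟨c, hanti hc, hc0, rfl⟩)
    exact ⟨heq, hpure _ fun y hy hy0 => heq ▸ hd ⟨y, hy, hy0, rfl⟩⟩

end Distance

/-! ### Extension of isotropic spaces -/

section Extension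

theorem notMem_sup_span_singleton {K V : Type*} [Field K] [AddCommGroup V] [Module K V]
    {D : Submodule K V} {a v : V} (ha : a ∉ D) (hv : v ∉ D ⊔ K ∙ a) : a ∉ D ⊔ K ∙ v := by
  intro h
  obtain ⟨y, hy, z, hz, rfl⟩ := Submodule.mem_sup.1 h
  obtain ⟨t, rfl⟩ := Submodule.mem_span_singleton.1 hz
  have ht : t ≠ 0 := by
    rintro rfl
    simp [hy] at ha
  refine hv ?_
  have hmem := Submodule.add_mem_sup (D.neg_mem (D.smul_mem t⁻¹ hy))
    (Submodule.smul_mem _ t⁻¹ (Submodule.mem_span_singleton_self (R := K) (y + t • v)))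
  rwa [smul_add, smul_smul, inv_mul_cancel₀ ht, one_smul, neg_add_cancel_left] at hmem

theorem finrank_sup_span_singleton_le {K V : Type*} [Field K] [AddCommGroup V] [Module K V]
    [FiniteDimensional K V] (D : Submodule K V) (a : V) :
    finrank K (D ⊔ K ∙ a : Submodule K V) ≤ finrank K D + 1 :=
  (Submodule.finrank_add_le_finrank_add_finrank D (K ∙ a)).trans
    (Nat.add_le_add_left ((finrank_span_le_card {a}).trans (by simp)) _)

theorem exists_mem_notMem_of_finrank_lt {K V : Type*} [Field K] [AddCommGroup V] [Module K V]
    [FiniteDimensional K V] {D C : Submodule K V} (h : finrank K D < finrank K C) :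
    ∃ v ∈ C, v ∉ D := by
  by_contra! hle
  exact (Submodule.finrank_mono (show C ≤ D from hle)).not_gt h

theorem exists_between_finrank_eq {K V : Type*} [Field K] [AddCommGroup V] [Module K V]
    [FiniteDimensional K V] {D C : Submodule K V} (hDC : D ≤ C) {a : V} (ha : a ∉ D) {e : ℕ}
    (hDe : finrank K D ≤ e) (heC : e < finrank K C) :
    ∃ D' : Submodule K V, D ≤ D' ∧ D' ≤ C ∧ a ∉ D' ∧ finrank K D' = e := by
  induction e, hDe using Nat.le_induction with
  | base => exact ⟨D, le_rfl, hDC, ha, rfl⟩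
  | succ e _ ih =>
    obtain ⟨D', h1, h2, h3, h4⟩ := ih (by omega)
    obtain ⟨v, hv, hv'⟩ := exists_mem_notMem_of_finrank_lt
      (lt_of_le_of_lt (finrank_sup_span_singleton_le D' a) (by omega : _ < finrank K C))
    have hvD : v ∉ D' := fun h => hv' (Submodule.mem_sup_left h)
    exact ⟨D' ⊔ K ∙ v, h1.trans le_sup_left,
      sup_le h2 ((Submodule.span_singleton_le_iff_mem _ _).2 hv),
      notMem_sup_span_singleton h3 hv', by rw [Submodule.finrank_sup_span_singleton hvD, h4]⟩

variable {F : Type*} [Field F] {n : ℕ}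

theorem mem_symplecticDual_sup_span_singleton
    {A : Submodule F ((Fin n → F) × (Fin n → F))} {x v : (Fin n → F) × (Fin n → F)} :
    x ∈ symplecticDual (A ⊔ F ∙ v) ↔ x ∈ symplecticDual A ∧ v.2 ⬝ᵥ x.1 = x.2 ⬝ᵥ v.1 := by
  constructor
  · exact fun h => ⟨symplecticDual_anti le_sup_left h, mem_symplecticDual.1 h v
      (Submodule.mem_sup_right (Submodule.mem_span_singleton_self v))⟩
  · rintro ⟨h1, h2⟩
    refine mem_symplecticDual.2 fun w hw => ?_
    obtain ⟨y, hy, z, hz, rfl⟩ := Submodule.mem_sup.1 hw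
    obtain ⟨t, rfl⟩ := Submodule.mem_span_singleton.1 hz
    simp only [Prod.snd_add, Prod.fst_add, Prod.smul_fst, Prod.smul_snd, add_dotProduct,
      dotProduct_add, smul_dotProduct, dotProduct_smul, mem_symplecticDual.1 h1 y hy, h2]

variable {p : ℕ} [Fact p.Prime] [Finite F] [Algebra (ZMod p) F]

/-- One step of the extension. In characteristic `2` the new vector has to be singular for the
quadratic form `b ⬝ a`; if a first choice `w` is not, then some `v + x w` is, with `v` orthogonal
to `w`, because every element of `F` is a square. -/
theorem exists_singular_notMem {A : Submodule F ((Fin n → F) × (Fin n → F))}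
    {c : (Fin n → F) × (Fin n → F)} (hn : finrank F A + 3 ≤ n) :
    ∃ v ∈ symplecticDual (A ⊔ F ∙ c), v ∉ A ⊔ F ∙ c ∧ (p = 2 → v.2 ⬝ᵥ v.1 = 0) := by
  have h1 := finrank_sup_span_singleton_le A c
  obtain ⟨w, hw, hwA⟩ := exists_mem_notMem_of_finrank_lt (D := A ⊔ F ∙ c)
    (C := symplecticDual (A ⊔ F ∙ c)) (by rw [finrank_symplecticDual]; omega)
  by_cases hp : p = 2
  · by_cases hw0 : w.2 ⬝ᵥ w.1 = 0
    · exact ⟨w, hw, hwA, fun _ => hw0⟩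
    have h2 := finrank_sup_span_singleton_le (A ⊔ F ∙ c) w
    obtain ⟨v, hv, hvA⟩ := exists_mem_notMem_of_finrank_lt (D := A ⊔ F ∙ c ⊔ F ∙ w)
      (C := symplecticDual (A ⊔ F ∙ c ⊔ F ∙ w)) (by rw [finrank_symplecticDual]; omega)
    rw [mem_symplecticDual_sup_span_singleton] at hv
    subst hp
    have : CharP F 2 := charP_of_injective_algebraMap (algebraMap (ZMod 2) F).injective 2
    obtain ⟨x, hx⟩ := FiniteField.isSquare_of_char_two (ringChar.eq F 2)
      (v.2 ⬝ᵥ v.1 / w.2 ⬝ᵥ w.1)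
    refine ⟨v + x • w, Submodule.add_mem _ hv.1 (Submodule.smul_mem _ x hw), fun h => hvA ?_,
      fun _ => ?_⟩
    · have := Submodule.add_mem_sup h (Submodule.smul_mem _ (-x)
        (Submodule.mem_span_singleton_self w))
      simpa using this
    · simp only [Prod.snd_add, Prod.fst_add, Prod.smul_fst, Prod.smul_snd, add_dotProduct,
        dotProduct_add, smul_dotProduct, dotProduct_smul, smul_eq_mul, hv.2]
      rw [div_eq_iff hw0] at hx
      rw [hx]
      linear_combination (x * x * (w.2 ⬝ᵥ w.1) + x * (v.2 ⬝ᵥ w.1)) * CharTwo.two_eq_zero (R := F)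
  · exact ⟨w, hw, hwA, fun h => absurd h hp⟩

/-- A totally isotropic space extends to one of prescribed dimension that still does not contain
a given vector `c` orthogonal to it. -/
theorem exists_isotropic_extension {A : Submodule F ((Fin n → F) × (Fin n → F))}
    (hA : A ≤ symplecticDual A) (h2 : p = 2 → ∀ v ∈ A, v.2 ⬝ᵥ v.1 = 0)
    {c : (Fin n → F) × (Fin n → F)} (hc : c ∈ symplecticDual A) (hcA : c ∉ A) {e : ℕ}
    (hAe : finrank F A ≤ e) (hen : e + 2 ≤ n) :
    ∃ A' : Submodule F ((Fin n → F) × (Fin n → F)), A ≤ A' ∧ A' ≤ symplecticDual A' ∧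
      (p = 2 → ∀ v ∈ A', v.2 ⬝ᵥ v.1 = 0) ∧ c ∈ symplecticDual A' ∧ c ∉ A' ∧
      finrank F A' = e := by
  induction e, hAe using Nat.le_induction with
  | base => exact ⟨A, le_rfl, hA, h2, hc, hcA, rfl⟩
  | succ e _ ih =>
    obtain ⟨A', h1, h3, h4, h5, h6, h7⟩ := ih (by omega)
    obtain ⟨v, hv, hvA, hv0⟩ := exists_singular_notMem (p := p) (A := A') (c := c) (by omega)
    have hvD : v ∉ A' := fun h => hvA (Submodule.mem_sup_left h)
    rw [mem_symplecticDual_sup_span_singleton] at hv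
    refine ⟨A' ⊔ F ∙ v, h1.trans le_sup_left, sup_le ?_ ?_, ?_, ?_,
      notMem_sup_span_singleton h6 hvA, by rw [Submodule.finrank_sup_span_singleton hvD, h7]⟩
    · exact fun x hx => mem_symplecticDual_sup_span_singleton.2
        ⟨h3 hx, (mem_symplecticDual.1 hv.1 x hx).symm⟩
    · rw [Submodule.span_singleton_le_iff_mem, mem_symplecticDual_sup_span_singleton]
      exact ⟨hv.1, rfl⟩
    · intro hp w hw
      obtain ⟨y, hy, z, hz, rfl⟩ := Submodule.mem_sup.1 hw
      obtain ⟨t, rfl⟩ := Submodule.mem_span_singleton.1 hz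
      have hyv := mem_symplecticDual.1 hv.1 y hy
      have hvv := hv0 hp
      have hyy := h4 hp y hy
      subst hp
      have : CharP F 2 := charP_of_injective_algebraMap (algebraMap (ZMod 2) F).injective 2
      simp only [Prod.snd_add, Prod.fst_add, Prod.smul_fst, Prod.smul_snd, add_dotProduct,
        dotProduct_add, smul_dotProduct, dotProduct_smul, smul_eq_mul, hyv, hvv, hyy]
      linear_combination (t * (v.2 ⬝ᵥ y.1)) * CharTwo.two_eq_zero (R := F)
    · exact mem_symplecticDual_sup_span_singleton.2 ⟨h5, hv.2.symm⟩

end Extension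

/-! ### Zeros of words and the BCH bound -/

section Words

variable {K L : Type*} [Field K] [Field L] [Algebra K L] {n : ℕ}

theorem eval_wordPoly (u : Fin n → K) (y : L) :
    (wordPoly L u).eval y = ∑ i, algebraMap K L (u i) * y ^ (i : ℕ) := by
  simp [wordPoly, Polynomial.eval_finsetSum]

theorem eval_wordPoly_pow_card [Fintype K] (u : Fin n → K) (y : L) (k : ℕ) :
    (wordPoly L u).eval (y ^ Fintype.card K ^ k) = (wordPoly L u).eval y ^ Fintype.card K ^ k := by
  induction k with
  | zero => simp
  | succ k ih =>
    rw [pow_succ, pow_mul, pow_mul, ← ih]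
    generalize y ^ Fintype.card K ^ k = y
    simp only [eval_wordPoly]
    have h := map_sum (FiniteField.frobeniusAlgHom K L)
      (fun i => algebraMap K L (u i) * y ^ (i : ℕ)) Finset.univ
    simp only [map_mul, AlgHom.commutes] at h
    simp only [FiniteField.coe_frobeniusAlgHom] at h
    rw [h]
    simp only [← pow_mul, mul_comm]

/-- The BCH bound: a nonzero word with `T` consecutive zeros has weight more than `T`, because
the columns of a Vandermonde matrix are independent. -/
theorem lt_hammingNorm_of_eval_eq_zero [DecidableEq K] {α : L} (hα : orderOf α = n)
    {u : Fin n → K} (hu : u ≠ 0) {s T : ℕ}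
    (h : ∀ j < T, (wordPoly L u).eval (α ^ (s + j)) = 0) : T < hammingNorm u := by
  by_contra! hT
  let S : Finset (Fin n) := Finset.univ.filter fun i => u i ≠ 0
  have hS : S.card = hammingNorm u := rfl
  let e : Fin S.card ≃ S := S.equivFin.symm
  have hα0 : α ≠ 0 := by
    rintro rfl
    obtain ⟨i, -⟩ := Function.ne_iff.1 hu
    have := i.pos
    simp at hα
    omega
  have hinj : Function.Injective fun i : Fin S.card => α ^ ((e i : Fin n) : ℕ) := by
    intro i j hij
    refine e.injective (Subtype.ext (Fin.ext (pow_injOn_Iio_orderOf ?_ ?_ hij))) <;>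
      simp [hα]
  have hv := Matrix.eq_zero_of_forall_pow_sum_mul_pow_eq_zero (f := fun i : Fin S.card =>
    α ^ ((e i : Fin n) : ℕ)) (v := fun i => algebraMap K L (u (e i)) * (α ^ s) ^ ((e i : Fin n) : ℕ))
    hinj ?_
  · obtain ⟨i, hi⟩ := Function.ne_iff.1 hu
    have hiS : i ∈ S := Finset.mem_filter.2 ⟨Finset.mem_univ _, hi⟩
    have := congrFun hv (e.symm ⟨i, hiS⟩)
    simp only [Equiv.apply_symm_apply, Pi.zero_apply, mul_eq_zero] at this
    refine this.elim (fun h0 => hi (by simpa using h0)) fun h0 => ?_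
    exact pow_ne_zero _ (pow_ne_zero _ hα0) h0
  · intro j
    have h1 := h j (by omega)
    rw [eval_wordPoly] at h1
    rw [Equiv.sum_comp e fun i : S => algebraMap K L (u i) * (α ^ s) ^ ((i : Fin n) : ℕ) *
      (α ^ ((i : Fin n) : ℕ)) ^ (j : ℕ), Finset.sum_coe_sort S fun i => algebraMap K L (u i) *
      (α ^ s) ^ (i : ℕ) * (α ^ (i : ℕ)) ^ (j : ℕ), Finset.sum_subset (Finset.subset_univ S), ← h1]
    · exact Finset.sum_congr rfl fun i _ => by ring
    · intro i _ hi
      have : u i = 0 := by simpa [S] using hi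
      simp [this]

end Words

/-! ### BCH codes as duals of trace codes -/

section BCH

/-- The numbers `1 ≤ x < δ` that are not divisible by `r`; they meet every `r`-cyclotomic coset
of the numbers `1, …, δ - 1`. -/
def cosetReps (r δ : ℕ) : Finset ℕ :=
  (Finset.Ico 1 δ).filter fun x => ¬ r ∣ x

theorem mem_cosetReps {r δ x : ℕ} : x ∈ cosetReps r δ ↔ (1 ≤ x ∧ x < δ) ∧ ¬ r ∣ x := by
  simp [cosetReps]

theorem exists_cosetReps_mul_pow {r δ x : ℕ} (hr : 2 ≤ r) (h1 : 1 ≤ x) (hx : x < δ) :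
    ∃ y ∈ cosetReps r δ, ∃ k, x = y * r ^ k := by
  obtain ⟨k, y, hy, rfl⟩ := Nat.exists_eq_pow_mul_and_not_dvd (by omega : x ≠ 0) r (by omega)
  have hpos : 0 < r ^ k := by positivity
  refine ⟨y, mem_cosetReps.2 ⟨⟨?_, ?_⟩, hy⟩, k, mul_comm _ _⟩
  · exact Nat.pos_of_ne_zero fun h => hy (by simp [h])
  · exact (Nat.le_mul_of_pos_left y hpos).trans_lt hx

variable {K L : Type*} [Field K] [Fintype K] [Field L] [Algebra K L] {n : ℕ} {α : L} {δ : ℕ}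

theorem prod_X_sub_C_pow_dvd_iff (hα : orderOf α = n) {Z : Finset ℕ} (hZ : ∀ z ∈ Z, z < n)
    (f : Polynomial L) :
    ∏ z ∈ Z, (Polynomial.X - Polynomial.C (α ^ z)) ∣ f ↔ ∀ z ∈ Z, f.eval (α ^ z) = 0 := by
  constructor
  · intro h z hz
    have hdvd := (Finset.dvd_prod_of_mem
      (fun z => Polynomial.X - Polynomial.C (α ^ z)) hz).trans h
    exact Polynomial.dvd_iff_isRoot.1 hdvd
  · intro h
    refine Finset.prod_dvd_of_coprime (fun z hz w hw hzw => ?_)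
      fun z hz => Polynomial.dvd_iff_isRoot.2 (h z hz)
    have hne : α ^ z ≠ α ^ w := fun h => hzw (pow_injOn_Iio_orderOf
      (Set.mem_Iio.2 ((hZ z (Finset.mem_coe.1 hz)).trans_eq hα.symm))
      (Set.mem_Iio.2 ((hZ w (Finset.mem_coe.1 hw)).trans_eq hα.symm)) h)
    exact Polynomial.isCoprime_X_sub_C_of_isUnit_sub (sub_ne_zero.2 hne).isUnit

theorem mem_bchCode_iff (hn : 0 < n) (hα : orderOf α = n) (u : Fin n → K) :
    u ∈ bchCode K n δ α ↔ ∀ x ∈ cosetReps (Fintype.card K) δ, (wordPoly L u).eval (α ^ x) = 0 := by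
  classical
  change bchGenerator (Fintype.card K) n δ α ∣ wordPoly L u ↔ _
  have hmem : ∀ z, z ∈ bchDefiningSet (Fintype.card K) n δ ↔
      z < n ∧ ∃ x, 1 ≤ x ∧ x < δ ∧ ∃ k, z = x * Fintype.card K ^ k % n := by
    intro z
    rw [bchDefiningSet, Finset.mem_filter, Finset.mem_range]
    rfl
  have hmod : ∀ x, α ^ (x % n) = α ^ x := fun x => by rw [← hα, pow_mod_orderOf]
  rw [bchGenerator, prod_X_sub_C_pow_dvd_iff hα fun z hz => ((hmem z).1 hz).1]
  constructor
  · intro h x hx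
    obtain ⟨⟨h1, h2⟩, -⟩ := mem_cosetReps.1 hx
    have := h (x % n) ((hmem _).2 ⟨Nat.mod_lt _ hn, x, h1, h2, 0, by simp⟩)
    rwa [hmod] at this
  · intro h z hz
    obtain ⟨-, x, h1, h2, k, rfl⟩ := (hmem z).1 hz
    obtain ⟨y, hy, l, rfl⟩ := exists_cosetReps_mul_pow (Fintype.one_lt_card (α := K)) h1 h2
    rw [hmod, mul_assoc, ← pow_add, pow_mul, eval_wordPoly_pow_card, h y hy,
      zero_pow (by simp)]

theorem eval_eq_zero_of_mem_bchCode (hn : 0 < n) (hα : orderOf α = n) {u : Fin n → K}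
    (hu : u ∈ bchCode K n δ α) {x : ℕ} (h1 : 1 ≤ x) (hx : x < δ) :
    (wordPoly L u).eval (α ^ x) = 0 := by
  obtain ⟨y, hy, l, rfl⟩ := exists_cosetReps_mul_pow (Fintype.one_lt_card (α := K)) h1 hx
  rw [pow_mul, eval_wordPoly_pow_card, (mem_bchCode_iff hn hα u).1 hu y hy, zero_pow (by simp)]

/-- The words `i ↦ ∑ z, tr (l z * α ^ (z i))`, where `z` runs over `cosetReps` and the
coefficients `l z` are in `L`. -/
noncomputable def traceWord (K : Type*) [Field K] [Fintype K] [Algebra K L] (n δ : ℕ) (α : L) :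
    (cosetReps (Fintype.card K) δ → L) →ₗ[K] (Fin n → K) :=
  LinearMap.pi fun i => ∑ z : cosetReps (Fintype.card K) δ,
    Algebra.trace K L ∘ₗ LinearMap.mulRight K (α ^ ((z : ℕ) * i)) ∘ₗ LinearMap.proj z

theorem traceWord_apply (l : cosetReps (Fintype.card K) δ → L) (i : Fin n) :
    traceWord K n δ α l i =
      ∑ z : cosetReps (Fintype.card K) δ, Algebra.trace K L (l z * α ^ ((z : ℕ) * i)) := by
  simp [traceWord]

/-- The trace code of the BCH code: by `mem_bchCode_iff_dotProduct` its dual is the BCH code. -/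
noncomputable def traceCode (K : Type*) [Field K] [Fintype K] [Algebra K L] (n δ : ℕ) (α : L) :
    Submodule K (Fin n → K) :=
  LinearMap.range (traceWord K n δ α)

variable [FiniteDimensional K L]

theorem finrank_traceCode_le :
    finrank K (traceCode K n δ α) ≤ finrank K L * (cosetReps (Fintype.card K) δ).card := by
  refine (LinearMap.finrank_range_le _).trans_eq ?_
  rw [finrank_pi_fintype]
  simp [mul_comm]

omit [FiniteDimensional K L] in
theorem dotProduct_traceWord (u : Fin n → K) (l : cosetReps (Fintype.card K) δ → L) :
    u ⬝ᵥ traceWord K n δ α l =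
      ∑ z : cosetReps (Fintype.card K) δ,
        Algebra.trace K L ((wordPoly L u).eval (α ^ (z : ℕ)) * l z) := by
  simp only [dotProduct, traceWord_apply, eval_wordPoly, Finset.mul_sum, Finset.sum_mul, map_sum]
  rw [Finset.sum_comm]
  refine Finset.sum_congr rfl fun z _ => Finset.sum_congr rfl fun i _ => ?_
  rw [← smul_eq_mul, ← map_smul, Algebra.smul_def, pow_mul]
  congr 1
  ring

theorem mem_bchCode_iff_dotProduct (hn : 0 < n) (hα : orderOf α = n) (u : Fin n → K) :
    u ∈ bchCode K n δ α ↔ ∀ d ∈ traceCode K n δ α, u ⬝ᵥ d = 0 := by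
  rw [mem_bchCode_iff hn hα]
  constructor
  · rintro h _ ⟨l, rfl⟩
    rw [dotProduct_traceWord]
    exact Finset.sum_eq_zero fun z _ => by rw [h z z.2, zero_mul, map_zero]
  · intro h x hx
    by_contra hne
    obtain ⟨y, hy⟩ := exists_trace_mul_ne_zero K hne
    have := h _ ⟨Pi.single ⟨x, hx⟩ y, rfl⟩
    rw [dotProduct_traceWord, Finset.sum_eq_single ⟨x, hx⟩] at this
    · simp only [Pi.single_eq_same] at this
      exact hy this
    · intro z _ hz
      simp [hz]
    · simp

/-- The zeros of the trace code and of its images under powers `s` of Frobenius: the trace is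
`∑ y ^ (r ^ l)`, and the powers of an `n`-th root of unity other than `1` sum to zero. -/
theorem eval_pow_eq_zero_of_mem_traceCode {p : ℕ} [Fact p.Prime] [CharP L p] (hα : orderOf α = n)
    {d : Fin n → K} (hd : d ∈ traceCode K n δ α) {s j : ℕ} (hs : ∃ a, s = p ^ a)
    (h : ∀ z, 1 ≤ z → z < δ → ∀ l < finrank K L, ¬ n ∣ z * (Fintype.card K ^ l * s) + j) :
    (wordPoly L fun i => d i ^ s).eval (α ^ j) = 0 := by
  obtain ⟨l, rfl⟩ := hd
  obtain ⟨a, rfl⟩ := hs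
  have hL : Finite L := Module.finite_of_finite K
  rw [eval_wordPoly]
  simp only [traceWord_apply, map_pow, map_sum, FiniteField.algebraMap_trace_eq_sum_pow,
    sum_pow_char_pow, Finset.sum_mul]
  rw [Finset.sum_comm]
  refine Finset.sum_eq_zero fun z _ => ?_
  rw [Finset.sum_comm]
  refine Finset.sum_eq_zero fun t ht => ?_
  obtain ⟨⟨h1, h2⟩, -⟩ := mem_cosetReps.1 z.2
  have hne := h z h1 h2 t (Finset.mem_range.1 ht)
  set β := α ^ ((z : ℕ) * (Fintype.card K ^ t * p ^ a) + j) with hβ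
  have hβ1 : β - 1 ≠ 0 := by
    rw [sub_ne_zero, hβ, Ne, ← orderOf_dvd_iff_pow_eq_one, hα]
    exact hne
  have hβn : β ^ n = 1 := by
    rw [hβ, ← pow_mul, mul_comm, pow_mul, ← hα, pow_orderOf_eq_one, one_pow]
  have hgeom : ∑ i : Fin n, β ^ (i : ℕ) = 0 := by
    rw [Fin.sum_univ_eq_sum_range fun i => β ^ i]
    have := geom_sum_mul β n
    rw [hβn, sub_self] at this
    exact (mul_eq_zero.1 this).resolve_right hβ1
  rw [← mul_zero (l z ^ (Fintype.card K ^ t * p ^ a)), ← hgeom, Finset.mul_sum]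
  refine Finset.sum_congr rfl fun i _ => ?_
  rw [Nat.card_eq_fintype_card, hβ]
  simp only [mul_pow, ← pow_mul]
  rw [mul_assoc, ← pow_add]
  congr 2
  ring

end BCH

/-! ### Divisibility of exponents -/

/-- Modulo `q ^ M - 1` the exponent `t` can be traded for `M - t`, and for small exponents
`z * q ^ t + j` lies strictly between `0` and `q ^ M - 1`. -/
theorem not_dvd_mul_pow_add {q M T h z j t : ℕ} (hq : 2 ≤ q) (hT : T * (1 + q ^ h) < q ^ M - 1)
    (hz : 1 ≤ z) (hzT : z ≤ T) (hj : j ≤ T) (ht : t < M) (hth : t ≤ h ∨ M - t ≤ h) :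
    ¬ q ^ M - 1 ∣ z * q ^ t + j := by
  have hM : 1 ≤ q ^ M := Nat.one_le_pow _ _ (by omega)
  have hsmall : ∀ x y s, x ≤ T → y ≤ T → s ≤ h → x + y * q ^ s < q ^ M - 1 := by
    intro x y s hx hy hs
    calc x + y * q ^ s ≤ T + T * q ^ h :=
          Nat.add_le_add hx (Nat.mul_le_mul hy (Nat.pow_le_pow_right (by omega) hs))
      _ = T * (1 + q ^ h) := by ring
      _ < _ := hT
  intro hdvd
  rcases hth with hth | hth
  · have h1 := hsmall j z t hj hzT hth
    have h2 : 0 < z * q ^ t := by positivity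
    exact (Nat.le_of_dvd (by omega) hdvd).not_gt (by omega)
  · have h1 := hsmall z j (M - t) hzT hj hth
    have h2 : (z * q ^ t + j) * q ^ (M - t) = z * (q ^ M - 1) + (z + j * q ^ (M - t)) := by
      have h3 : q ^ M = q ^ t * q ^ (M - t) := by rw [← pow_add]; congr 1; omega
      have h4 : z * (q ^ M - 1) + z = z * q ^ M := by
        rw [Nat.mul_sub, mul_one, Nat.sub_add_cancel (Nat.le_mul_of_pos_right z hM)]
      rw [← add_assoc, h4, h3]
      ring
    have h3 := hdvd.mul_right (q ^ (M - t))
    rw [h2] at h3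
    have h4 := (Nat.dvd_add_right (Dvd.intro_left z rfl)).1 h3
    exact (Nat.le_of_dvd (by omega) h4).not_gt h1

/-! ### The Euclidean construction -/

theorem finrank_submodule_prod {K V W : Type*} [Field K] [AddCommGroup V] [Module K V]
    [AddCommGroup W] [Module K W] [FiniteDimensional K V] [FiniteDimensional K W]
    (C : Submodule K V) (D : Submodule K W) :
    finrank K (C.prod D) = finrank K C + finrank K D := by
  let e : C.prod D ≃ₗ[K] C × D :=
    { toFun x := (⟨x.1.1, x.2.1⟩, ⟨x.1.2, x.2.2⟩)
      invFun x := ⟨(x.1.1, x.2.1), ⟨x.1.2, x.2.2⟩⟩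
      map_add' _ _ := rfl
      map_smul' _ _ := rfl }
  rw [e.finrank_eq, finrank_prod]

section Weight

variable {F : Type*} [Field F] [DecidableEq F] {n : ℕ}

theorem errorWeight_zero_right (a : Fin n → F) : errorWeight a 0 = hammingNorm a := by
  simp [errorWeight, hammingNorm]

theorem hammingNorm_le_errorWeight_left (a b : Fin n → F) : hammingNorm a ≤ errorWeight a b :=
  Finset.card_le_card fun i hi => by
    simp only [Finset.mem_filter, Finset.mem_univ, true_and, ne_eq] at hi ⊢
    exact fun h => hi (Prod.mk.inj h).1

theorem hammingNorm_le_errorWeight_right (a b : Fin n → F) : hammingNorm b ≤ errorWeight a b :=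
  Finset.card_le_card fun i hi => by
    simp only [Finset.mem_filter, Finset.mem_univ, true_and, ne_eq] at hi ⊢
    exact fun h => hi (Prod.mk.inj h).2

end Weight

section Euclid

variable {p : ℕ} [Fact p.Prime] {F : Type*} [Field F] [Fintype F] [DecidableEq F]
  [Algebra (ZMod p) F] {L : Type*} [Field L] [Algebra F L] [FiniteDimensional F L]

/-- The stabilizer code of `D × D` with `D` the trace code. The first factor is enlarged to reach
the prescribed dimension. -/
theorem exists_stabilizerCode_euclid {n m δ T : ℕ} {α : L} (hm : finrank F L = m)
    (hα : orderOf α = n) (hδ : 1 ≤ δ) (hδT : δ ≤ T + 1)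
    (hdvd : ∀ z, 1 ≤ z → z ≤ T → ∀ j ≤ T, ∀ l < m, ¬ n ∣ z * Fintype.card F ^ l + j)
    (hdim : 2 * m * (cosetReps (Fintype.card F) δ).card < n) :
    ∃ (k dQ : ℕ) (Q : Submodule ℂ (QuditSpace F n)),
      2 * m * (cosetReps (Fintype.card F) δ).card + k = n ∧
      IsStabilizerCodeWith p Q k dQ ∧ δ ≤ dQ ∧ IsPureTo p Q δ ∧
      ∀ d, CodeHasMinDist (bchCode F n δ α) d → d ≤ T + 1 → dQ = d ∧ IsPureTo p Q dQ := by
  have hn : 0 < n := by omega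
  set D := traceCode F n δ α
  set C := bchCode F n δ α
  set N := (cosetReps (Fintype.card F) δ).card
  have hFp : CharP F p := charP_of_injective_algebraMap (algebraMap (ZMod p) F).injective p
  have : CharP L p := charP_of_injective_algebraMap (algebraMap F L).injective p
  have hzero : ∀ d ∈ D, ∀ j ≤ T, (wordPoly L d).eval (α ^ j) = 0 := by
    intro d hd j hj
    have := eval_pow_eq_zero_of_mem_traceCode (p := p) hα hd (s := 1) (j := j) ⟨0, by simp⟩
      fun z h1 h2 l hl => by
        rw [mul_one]
        exact hdvd z h1 (by omega) j hj l (hm ▸ hl)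
    simpa using this
  have hDC : D ≤ C := fun d hd => (mem_bchCode_iff hn hα d).2 fun x hx =>
    hzero d hd x (by have := (mem_cosetReps.1 hx).1; omega)
  have hDw : ∀ d ∈ D, d ≠ 0 → T + 1 < hammingNorm d := fun d hd h0 =>
    lt_hammingNorm_of_eval_eq_zero hα h0 (s := 0) fun j hj => by
      rw [zero_add]; exact hzero d hd j (by omega)
  have hCw : ∀ u ∈ C, u ≠ 0 → δ ≤ hammingNorm u := fun u hu h0 => by
    have := lt_hammingNorm_of_eval_eq_zero hα h0 (s := 1) (T := δ - 1) fun j hj =>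
      eval_eq_zero_of_mem_bchCode hn hα hu (by omega) (by omega)
    omega
  have hdot : ∀ u, u ∈ C ↔ ∀ d ∈ D, u ⬝ᵥ d = 0 := mem_bchCode_iff_dotProduct hn hα
  have hdual : symplecticDual (D.prod D) = C.prod C := by
    ext x
    rw [mem_symplecticDual, Submodule.mem_prod, hdot, hdot]
    constructor
    · intro h
      constructor
      · intro d hd
        simpa [dotProduct_comm] using h (0, d) ⟨D.zero_mem, hd⟩
      · intro d hd
        simpa using (h (d, 0) ⟨hd, D.zero_mem⟩).symm
    · rintro ⟨h1, h2⟩ v hv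
      rw [h2 _ hv.1, dotProduct_comm, h1 _ hv.2]
  have hDN : finrank F D ≤ m * N := hm ▸ finrank_traceCode_le
  have hCdim : finrank F C = n - finrank F D := by
    have := finrank_symplecticDual (D.prod D)
    rw [hdual, finrank_submodule_prod, finrank_submodule_prod] at this
    omega
  -- a word of least weight in `C` outside of `D`
  have hex : ∃ w, ∃ u ∈ C, u ∉ D ∧ hammingNorm u = w := by
    obtain ⟨u, hu, huD⟩ := exists_mem_notMem_of_finrank_lt (D := D) (C := C) (by
      rw [hCdim]; rw [mul_assoc] at hdim; omega)
    exact ⟨_, u, hu, huD, rfl⟩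
  classical
  obtain ⟨a, ha, haD, haw⟩ := Nat.find_spec hex
  have hmin : ∀ u ∈ C, u ∉ D → hammingNorm a ≤ hammingNorm u := fun u hu huD => by
    rw [haw]; exact Nat.find_min' hex ⟨u, hu, huD, rfl⟩
  obtain ⟨D', h1, h2, h3, h4⟩ := exists_between_finrank_eq hDC haD
    (e := 2 * m * N - finrank F D) (by rw [mul_assoc]; omega)
    (by rw [hCdim]; rw [mul_assoc] at hdim ⊢; omega)
  have hrank : finrank F (D'.prod D) = 2 * m * N := by
    rw [finrank_submodule_prod, h4, Nat.sub_add_cancel]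
    rw [mul_assoc]; omega
  have hC' : ∀ x ∈ C.prod C, x ≠ 0 → δ ≤ symplecticWeight x := by
    rintro ⟨x, y⟩ ⟨hx, hy⟩ h0
    by_cases hx0 : x = 0
    · exact (hCw y hy fun h => h0 (by simp [hx0, h])).trans (hammingNorm_le_errorWeight_right _ _)
    · exact (hCw x hx hx0).trans (hammingNorm_le_errorWeight_left _ _)
  have hA' : D'.prod D ≤ symplecticDual (D'.prod D) := by
    rintro x ⟨hx, hx'⟩
    refine mem_symplecticDual.2 fun v hv => ?_
    rw [dotProduct_comm, (hdot _).1 (h2 hx) _ hv.2, dotProduct_comm, (hdot _).1 (h2 hv.1) _ hx']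
  have hsing : p = 2 → ∀ v ∈ D'.prod D, v.2 ⬝ᵥ v.1 = 0 := by
    rintro - v hv
    rw [dotProduct_comm, (hdot _).1 (h2 hv.1) _ hv.2]
  have hc : (a, 0) ∈ symplecticDual (D'.prod D) := by
    refine mem_symplecticDual.2 fun v hv => ?_
    rw [dotProduct_comm, (hdot _).1 ha _ hv.2, zero_dotProduct]
  have hcmin : ∀ x ∈ symplecticDual (D.prod D), x ∉ D.prod D →
      symplecticWeight (a, 0) ≤ symplecticWeight x := by
    rintro ⟨x, y⟩ hxy hxyD
    rw [hdual] at hxy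
    change errorWeight a 0 ≤ errorWeight x y
    rw [errorWeight_zero_right]
    by_cases hx : x ∈ D
    · exact (hmin y hxy.2 fun h => hxyD ⟨hx, h⟩).trans (hammingNorm_le_errorWeight_right _ _)
    · exact (hmin x hxy.1 hx).trans (hammingNorm_le_errorWeight_left _ _)
  have hDT : ∀ x ∈ D.prod D, x ≠ 0 → T + 1 < symplecticWeight x := by
    rintro ⟨x, y⟩ ⟨hx, hy⟩ h0
    by_cases hx0 : x = 0
    · exact (hDw y hy fun h => h0 (by simp [hx0, h])).trans_le
        (hammingNorm_le_errorWeight_right _ _)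
    · exact (hDw x hx hx0).trans_le (hammingNorm_le_errorWeight_left _ _)
  obtain ⟨dQ, Q, hQ1, hQ2, hQ3, hQ4⟩ := exists_stabilizerCode_of_le (p := p)
    (k := n - 2 * m * N) (Submodule.prod_mono h1 le_rfl) hA' hsing (by rw [hrank]; omega) hc
    (fun h => h3 h.1) hcmin (hdual ▸ hC') hDT
  refine ⟨n - 2 * m * N, dQ, Q, by omega, hQ1, hQ2, hQ3, fun d hd hdT => hQ4 d ?_ hdT⟩
  obtain ⟨⟨u, hu, hu0, hud⟩, hlow⟩ := hd
  rw [hdual]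
  refine ⟨⟨(u, 0), ⟨hu, C.zero_mem⟩, by simpa using hu0, ?_⟩, ?_⟩
  · rw [← hud]
    exact errorWeight_zero_right u
  · rintro w ⟨⟨x, y⟩, ⟨hx, hy⟩, h0, rfl⟩
    by_cases hx0 : x = 0
    · exact (hlow ⟨y, hy, fun h => h0 (by simp [hx0, h]), rfl⟩).trans
        (hammingNorm_le_errorWeight_right _ _)
    · exact (hlow ⟨x, hx, hx0, rfl⟩).trans (hammingNorm_le_errorWeight_left _ _)

end Euclid

/-! ### The Hermitian construction -/

/-- The map `(a, b) ↦ a x + b y` from `F^n × F^n` to `K^n`. -/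
def coordMap (F : Type*) {K : Type*} [Field F] [Field K] [Algebra F K] (n : ℕ) (x y : K) :
    (Fin n → F) × (Fin n → F) →ₗ[F] (Fin n → K) where
  toFun v i := v.1 i • x + v.2 i • y
  map_add' v w := by
    ext i
    simp only [Prod.fst_add, Prod.snd_add, Pi.add_apply, add_smul]
    ring
  map_smul' r v := by
    ext i
    simp [mul_smul]

section CoordMap

variable {F K : Type*} [Field F] [Field K] [Algebra F K] {n : ℕ}

theorem coordMap_apply (x y : K) (v : (Fin n → F) × (Fin n → F)) (i : Fin n) :
    coordMap F n x y v i = v.1 i • x + v.2 i • y := rfl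

/-- The coordinate maps turn the symplectic form into a difference of two dot products, which
for `x' = x ^ q` and `y' = y ^ q` are conjugate. -/
theorem coordMap_dotProduct_sub (x y x' y' : K) (u v : (Fin n → F) × (Fin n → F)) :
    coordMap F n x y u ⬝ᵥ coordMap F n x' y' v - coordMap F n x' y' u ⬝ᵥ coordMap F n x y v =
      (x * y' - y * x') * algebraMap F K (u.1 ⬝ᵥ v.2 - u.2 ⬝ᵥ v.1) := by
  simp only [dotProduct, coordMap_apply, Algebra.smul_def, map_sub, map_sum, map_mul,
    ← Finset.sum_sub_distrib, Finset.mul_sum]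
  exact Finset.sum_congr rfl fun i _ => by ring

theorem symplecticWeight_eq_hammingNorm_coordMap [DecidableEq F] [DecidableEq K] {x y : K}
    (hxy : ∀ a b : F, a • x + b • y = 0 → a = 0 ∧ b = 0) (v : (Fin n → F) × (Fin n → F)) :
    symplecticWeight v = hammingNorm (coordMap F n x y v) := by
  refine congrArg Finset.card (Finset.filter_congr fun i _ => not_congr ?_)
  rw [coordMap_apply]
  constructor
  · intro h
    obtain ⟨h1, h2⟩ := Prod.mk.inj h
    simp [h1, h2]
  · intro h
    obtain ⟨h1, h2⟩ := hxy _ _ h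
    rw [h1, h2]

theorem coordMap_injective {x y : K} (hxy : ∀ a b : F, a • x + b • y = 0 → a = 0 ∧ b = 0) :
    Function.Injective (coordMap F n x y) := by
  refine (injective_iff_map_eq_zero _).2 fun v hv => Prod.ext ?_ ?_ <;> ext i
  · exact (hxy _ _ (congrFun hv i)).1
  · exact (hxy _ _ (congrFun hv i)).2

theorem coordMap_bijective (hK : finrank F K = 2) {x y : K}
    (hxy : ∀ a b : F, a • x + b • y = 0 → a = 0 ∧ b = 0) :
    Function.Bijective (coordMap F n x y) := by
  have : FiniteDimensional F K := finite_of_finrank_pos (by omega)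
  refine ⟨coordMap_injective hxy, (LinearMap.injective_iff_surjective_of_finrank_eq_finrank ?_).1
    (coordMap_injective hxy)⟩
  rw [finrank_prod, finrank_pi_fintype, finrank_pi_fintype]
  simp [hK, mul_two]

variable [Fintype F]

theorem coordMap_pow_card (x y : K) (v : (Fin n → F) × (Fin n → F)) (i : Fin n) :
    coordMap F n x y v i ^ Fintype.card F =
      coordMap F n (x ^ Fintype.card F) (y ^ Fintype.card F) v i := by
  have h := map_add (FiniteField.frobeniusAlgHom F K) (v.1 i • x) (v.2 i • y)
  simp only [map_smul] at h
  simp only [FiniteField.coe_frobeniusAlgHom] at h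
  exact h

end CoordMap

section Hermite

theorem exists_pow_ne_self {K : Type*} [Field K] [Fintype K] {q : ℕ} (hq : 2 ≤ q)
    (hK : Fintype.card K = q ^ 2) : ∃ w : K, w ^ q ≠ w := by
  classical
  obtain ⟨g, hg⟩ := exists_pow_ne_one_of_isCyclic (G := Kˣ) (k := q - 1) (by omega) (by
    rw [Nat.card_eq_fintype_card, Fintype.card_units, hK]
    have : q * 2 ≤ q ^ 2 := by rw [sq]; exact Nat.mul_le_mul_left q hq
    omega)
  refine ⟨g, fun h => hg (Units.ext ?_)⟩
  have h1 : (g : K) ^ (q - 1) * g = 1 * g := by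
    rw [← pow_succ, Nat.sub_add_cancel (by omega), h, one_mul]
  simpa using mul_right_cancel₀ g.ne_zero h1

variable {p : ℕ} [Fact p.Prime] {F : Type*} [Field F] [Fintype F] [DecidableEq F]
  [Algebra (ZMod p) F] {K : Type*} [Field K] [Fintype K] [DecidableEq K] [Algebra F K]
  {L : Type*} [Field L] [Algebra K L] [FiniteDimensional K L]

/-- Let `D` be the trace code, `C` the BCH code, and identify `F^n × F^n` with `K^n` by means of
a basis `x`, `y` of `K` over `F`. The Hermitian dual of `C` consists of the conjugates of the
words in `D`; the isotropic space that it gives is enlarged to reach the prescribed dimension.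
In characteristic `2` it is singular because its words have coordinate sum `0`. -/
theorem exists_stabilizerCode_hermite {n m δ T q : ℕ} {α : L} (hF : Fintype.card F = q)
    (hK : Fintype.card K = q ^ 2) (hm : finrank K L = m)
    (hα : orderOf α = n) (hδ : 1 ≤ δ) (hδT : δ ≤ T + 1)
    (hdvd : ∀ z, 1 ≤ z → z ≤ T → ∀ j ≤ T, ∀ l < m, ¬ n ∣ z * q ^ (2 * l + 1) + j)
    (hdim : 2 * m * (cosetReps (q ^ 2) δ).card + 2 ≤ n) :
    ∃ (k dQ : ℕ) (Q : Submodule ℂ (QuditSpace F n)),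
      2 * m * (cosetReps (q ^ 2) δ).card + k = n ∧
      IsStabilizerCodeWith p Q k dQ ∧ δ ≤ dQ ∧ IsPureTo p Q δ ∧
      ∀ d, CodeHasMinDist (bchCode K n δ α) d → d ≤ T + 1 → dQ = d ∧ IsPureTo p Q dQ := by
  have hn : 0 < n := by omega
  have hq : 2 ≤ q := hF ▸ Fintype.one_lt_card
  set D := traceCode K n δ α
  set C := bchCode K n δ α
  rw [← hK] at hdim ⊢
  set N := (cosetReps (Fintype.card K) δ).card
  have hFp : CharP F p := charP_of_injective_algebraMap (algebraMap (ZMod p) F).injective p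
  have hKp : CharP K p := charP_of_injective_algebraMap (algebraMap F K).injective p
  have hLp : CharP L p := charP_of_injective_algebraMap (algebraMap K L).injective p
  have hFK : finrank F K = 2 := by
    have h := Module.card_eq_pow_finrank (K := F) (V := K)
    rw [hF, hK] at h
    exact (Nat.pow_right_injective hq h).symm
  have hdot : ∀ u, u ∈ C ↔ ∀ d ∈ D, u ⬝ᵥ d = 0 := mem_bchCode_iff_dotProduct hn hα
  have hCw : ∀ u ∈ C, u ≠ 0 → δ ≤ hammingNorm u := fun u hu h0 => by
    have := lt_hammingNorm_of_eval_eq_zero hα h0 (s := 1) (T := δ - 1) fun j hj =>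
      eval_eq_zero_of_mem_bchCode hn hα hu (by omega) (by omega)
    omega
  have hDN : finrank K D ≤ m * N := hm ▸ finrank_traceCode_le
  -- a basis of `K` over `F`, and its conjugate
  obtain ⟨x, y, hxy⟩ : ∃ x y : K, ∀ a b : F, a • x + b • y = 0 → a = 0 ∧ b = 0 := by
    have : FiniteDimensional F K := finite_of_finrank_pos (by omega)
    let b := finBasisOfFinrankEq F K hFK
    refine ⟨b 0, b 1, fun a a' h => ?_⟩
    have h' := Fintype.linearIndependent_iff.1 b.linearIndependent ![a, a']
      (by simpa [Fin.sum_univ_two] using h)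
    exact ⟨h' 0, h' 1⟩
  have hxy' : ∀ a b : F, a • x ^ q + b • y ^ q = 0 → a = 0 ∧ b = 0 := by
    intro a b hab
    refine hxy a b (pow_eq_zero_iff (n := q) (by omega) |>.1 ?_)
    have h := coordMap_pow_card (n := 1) x y (fun _ => a, fun _ => b) 0
    rw [hF] at h
    exact h.trans hab
  set φ := coordMap F n x y with hφ
  set ψ := coordMap F n (x ^ q) (y ^ q) with hψ
  have hφb : Function.Bijective φ := coordMap_bijective hFK hxy
  have hψb : Function.Bijective ψ := coordMap_bijective hFK hxy'
  have hφψ : ∀ v i, φ v i ^ q = ψ v i := fun v i => by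
    have h := coordMap_pow_card x y v i
    rwa [hF] at h
  have hψφ : ∀ v i, ψ v i ^ q = φ v i := fun v i => by
    rw [← hφψ, ← pow_mul, ← sq, ← hK, FiniteField.pow_card]
  have hconj : ∀ u v, (φ u ⬝ᵥ ψ v) ^ q = ψ u ⬝ᵥ φ v := fun u v => by
    have h := map_sum (FiniteField.frobeniusAlgHom F K) (fun i => φ u i * ψ v i) Finset.univ
    simp only [map_mul] at h
    simp only [FiniteField.coe_frobeniusAlgHom, hF, hφψ, hψφ] at h
    exact h
  obtain ⟨w, hw⟩ := exists_pow_ne_self hq hK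
  have hγ : x * y ^ q - y * x ^ q ≠ 0 := by
    intro h0
    -- otherwise `u * v ^ q = u ^ q * v` for all `u` and `v` in `K`
    obtain ⟨u, hu⟩ := (coordMap_bijective (n := 1) hFK hxy).2 fun _ => 1
    obtain ⟨v, hv⟩ := (coordMap_bijective (n := 1) hFK hxy).2 fun _ => w
    have h1 := coordMap_dotProduct_sub x y (x ^ q) (y ^ q) u v
    have hu' := coordMap_pow_card x y u 0
    have hv' := coordMap_pow_card x y v 0
    rw [hF] at hu' hv'
    rw [h0, zero_mul] at h1
    simp only [dotProduct, Finset.univ_unique, Fin.default_eq_zero, Finset.sum_singleton, ← hu',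
      ← hv', hu, hv, one_pow, one_mul] at h1
    exact hw (sub_eq_zero.1 h1)
  have hform : ∀ u v : (Fin n → F) × (Fin n → F), v.2 ⬝ᵥ u.1 = u.2 ⬝ᵥ v.1 ↔
      (φ u ⬝ᵥ ψ v) ^ q = φ u ⬝ᵥ ψ v := fun u v => by
    rw [hconj, eq_comm (b := φ u ⬝ᵥ ψ v), ← sub_eq_zero, ← sub_eq_zero (b := ψ u ⬝ᵥ φ v),
      coordMap_dotProduct_sub, mul_eq_zero, or_iff_right hγ,
      map_eq_zero_iff _ (algebraMap F K).injective, dotProduct_comm v.2]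
  set A : Submodule F ((Fin n → F) × (Fin n → F)) := (D.restrictScalars F).comap ψ
  have hmemA : ∀ v, v ∈ A ↔ ψ v ∈ D := fun v => Iff.rfl
  have hdual : ∀ v, v ∈ symplecticDual A ↔ φ v ∈ C := by
    intro v
    rw [mem_symplecticDual, hdot]
    constructor
    · intro h d hd
      by_contra hne
      -- the multiples of `φ v ⬝ d` fill `K`, but conjugation would fix all of them
      obtain ⟨v', hv'⟩ := hψb.2 ((w / (φ v ⬝ᵥ d)) • d)
      have h1 := (hform v v').1 (h v' (by rw [hmemA, hv']; exact D.smul_mem _ hd))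
      rw [hv', dotProduct_smul, smul_eq_mul, div_mul_cancel₀ _ hne] at h1
      exact hw h1
    · intro h v' hv'
      rw [hform, h _ hv', zero_pow (by omega)]
  have hzero : ∀ v ∈ A, ∀ j ≤ T, (wordPoly L (φ v)).eval (α ^ j) = 0 := by
    intro v hv j hj
    have hqp : ∃ a, q = p ^ a := by
      obtain ⟨a, -, ha⟩ := FiniteField.card F p
      exact ⟨a, hF ▸ ha⟩
    have := eval_pow_eq_zero_of_mem_traceCode (p := p) hα ((hmemA v).1 hv) (j := j) hqp
      fun z h1 h2 l hl => by
        rw [hK, ← pow_mul, ← pow_succ]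
        exact hdvd z h1 (by omega) j hj l (hm ▸ hl)
    simpa only [hψφ] using this
  have hAC : ∀ v ∈ A, φ v ∈ C := fun v hv => (mem_bchCode_iff hn hα _).2 fun z hz =>
    hzero v hv z (by have := (mem_cosetReps.1 hz).1; omega)
  have hAA : A ≤ symplecticDual A := fun v hv => (hdual v).2 (hAC v hv)
  have hsing : p = 2 → ∀ v ∈ A, v.2 ⬝ᵥ v.1 = 0 := by
    rintro rfl v hv
    have h0 := hzero v hv 0 (Nat.zero_le _)
    simp only [eval_wordPoly, pow_zero, one_pow, mul_one] at h0
    rw [← map_sum, map_eq_zero_iff _ (algebraMap K L).injective] at h0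
    have h1 : (∑ i, v.1 i) • x + (∑ i, v.2 i) • y = 0 := by
      rw [← h0, Finset.sum_smul, Finset.sum_smul, ← Finset.sum_add_distrib]
      rfl
    obtain ⟨ha, hb⟩ := hxy _ _ h1
    have haa : v.1 ⬝ᵥ v.1 = 0 := by
      have := CharTwo.sum_mul_self Finset.univ v.1
      rw [ha, zero_mul] at this
      exact this.symm
    have hbb : v.2 ⬝ᵥ v.2 = 0 := by
      have := CharTwo.sum_mul_self Finset.univ v.2
      rw [hb, zero_mul] at this
      exact this.symm
    have h2 := (hdot _).1 (hAC v hv) _ ((hmemA v).1 hv)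
    have h3 : φ v ⬝ᵥ ψ v = algebraMap F K (v.1 ⬝ᵥ v.1) * (x * x ^ q) +
        algebraMap F K (v.2 ⬝ᵥ v.1) * (x * y ^ q - y * x ^ q + 2 * (y * x ^ q)) +
        algebraMap F K (v.2 ⬝ᵥ v.2) * (y * y ^ q) := by
      simp only [dotProduct, hφ, hψ, coordMap_apply, Algebra.smul_def, map_sum, map_mul,
        Finset.sum_mul, ← Finset.sum_add_distrib]
      exact Finset.sum_congr rfl fun i _ => by ring
    rw [h2, haa, hbb, CharTwo.two_eq_zero] at h3
    simp only [map_zero, zero_mul, zero_add, add_zero] at h3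
    exact (map_eq_zero_iff _ (algebraMap F K).injective).1
      ((mul_eq_zero.1 h3.symm).resolve_right hγ)
  have hwt : ∀ v, symplecticWeight v = hammingNorm (φ v) :=
    symplecticWeight_eq_hammingNorm_coordMap hxy
  have hφ0 : ∀ v, φ v ≠ 0 ↔ v ≠ 0 := fun v => (map_ne_zero_iff φ hφb.1)
  have hrank : finrank F A ≤ 2 * m * N := by
    have h1 : finrank F A ≤ finrank F (D.restrictScalars F) := by
      refine LinearMap.finrank_le_finrank_of_injective
        (f := ψ.restrict (p := A) (q := D.restrictScalars F) fun v hv => hv) ?_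
      exact fun u v huv => Subtype.ext (hψb.1 (congrArg Subtype.val huv))
    have h2 : finrank F (D.restrictScalars F) = 2 * finrank K D := by
      rw [← hFK]
      exact (finrank_mul_finrank F K D).symm
    rw [h2] at h1
    rw [mul_assoc]
    omega
  -- a vector of least weight in the dual of `A` and outside of `A`
  have hex : ∃ s, ∃ v ∈ symplecticDual A, v ∉ A ∧ symplecticWeight v = s := by
    obtain ⟨v, hv, hvA⟩ := exists_mem_notMem_of_finrank_lt (D := A) (C := symplecticDual A) (by
      rw [finrank_symplecticDual]; omega)
    exact ⟨_, v, hv, hvA, rfl⟩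
  classical
  obtain ⟨c, hc, hcA, hcw⟩ := Nat.find_spec hex
  have hmin : ∀ v ∈ symplecticDual A, v ∉ A → symplecticWeight c ≤ symplecticWeight v :=
    fun v hv hvA => by rw [hcw]; exact Nat.find_min' hex ⟨v, hv, hvA, rfl⟩
  obtain ⟨A', h1, h2, h3, h4, h5, h6⟩ := exists_isotropic_extension hAA hsing hc hcA hrank hdim
  obtain ⟨dQ, Q, hQ1, hQ2, hQ3, hQ4⟩ := exists_stabilizerCode_of_le (p := p)
    (k := n - 2 * m * N) (δ := δ) (T := T + 1) h1 h2 h3 (by rw [h6]; omega) h4 h5 hmin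
    (fun v hv h0 => by rw [hwt]; exact hCw _ ((hdual v).1 hv) ((hφ0 v).2 h0))
    (fun v hv h0 => by
      rw [hwt]
      exact lt_hammingNorm_of_eval_eq_zero hα ((hφ0 v).2 h0) (s := 0) fun j hj => by
        rw [zero_add]; exact hzero v hv j (by omega))
  refine ⟨n - 2 * m * N, dQ, Q, by omega, hQ1, hQ2, hQ3, fun d hd hdT => hQ4 d ?_ hdT⟩
  rw [CodeHasMinDist] at hd
  convert hd using 1
  ext s
  constructor
  · rintro ⟨v, hv, h0, rfl⟩
    exact ⟨φ v, (hdual v).1 hv, (hφ0 v).2 h0, (hwt v).symm⟩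
  · rintro ⟨u, hu, h0, rfl⟩
    obtain ⟨v, rfl⟩ := hφb.2 u
    exact ⟨v, (hdual v).2 hu, (hφ0 v).1 h0, hwt v⟩

end Hermite

/-! ### Counting and numerical bounds -/

theorem card_cosetReps (r d : ℕ) : (cosetReps r (d + 1)).card = d - d / r := by
  have h1 := Finset.card_filter_add_card_filter_not (s := Finset.Ico 1 (d + 1)) (fun x => r ∣ x)
  have h2 : Finset.Ico 1 (d + 1) = Finset.Ioc 0 d := by ext; simp; omega
  rw [h2, Nat.Ioc_filter_dvd_card_eq_div] at h1
  rw [cosetReps, h2]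
  simp only [Nat.card_Ioc] at h1
  omega

theorem card_cosetReps_mono (r : ℕ) {δ δ' : ℕ} (h : δ ≤ δ') :
    (cosetReps r δ).card ≤ (cosetReps r δ').card :=
  Finset.card_le_card (Finset.filter_subset_filter _ (Finset.Ico_subset_Ico_right h))

theorem ceil_eq_card_cosetReps {r δ : ℕ} (hr : 0 < r) (hδ : 1 ≤ δ) :
    ⌈((δ : ℚ) - 1) * (1 - 1 / (r : ℚ))⌉ = (cosetReps r δ).card := by
  obtain ⟨d, rfl⟩ := Nat.exists_eq_add_of_le' hδ
  rw [card_cosetReps, Int.ceil_eq_iff]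
  have hr' : (0 : ℚ) < r := by exact_mod_cast hr
  have h1 : ((d / r : ℕ) : ℚ) ≤ d / r := by
    rw [le_div_iff₀ hr']
    exact_mod_cast Nat.div_mul_le_self d r
  have h2 : (d : ℚ) / r < (d / r : ℕ) + 1 := by
    rw [div_lt_iff₀ hr']
    have := Nat.lt_div_mul_add (a := d) hr
    rw [add_mul, one_mul]
    exact_mod_cast this
  have h3 : ((d + 1 : ℕ) - 1 : ℚ) * (1 - 1 / r) = d - d / r := by
    push_cast
    ring
  have h4 : (((d - d / r : ℕ) : ℤ) : ℚ) = d - (d / r : ℕ) := by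
    rw [Int.cast_natCast, Nat.cast_sub (Nat.div_le_self d r)]
  rw [h3, h4]
  constructor <;> linarith

theorem two_mul_le_pow {q : ℕ} (hq : 2 ≤ q) (s : ℕ) : 2 * s ≤ q ^ s := by
  refine le_trans ?_ (Nat.pow_le_pow_left hq s)
  induction s with
  | zero => simp
  | succ s ih =>
    rcases s.eq_zero_or_pos with rfl | hs
    · simp
    · rw [pow_succ]; omega

theorem four_mul_le_pow {q s : ℕ} (hq : 3 ≤ q) (hs : 2 ≤ s) : 4 * s ≤ q ^ s := by
  refine le_trans ?_ (Nat.pow_le_pow_left hq s)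
  induction s, hs using Nat.le_induction with
  | base => norm_num
  | succ s hs ih => rw [pow_succ]; omega

theorem card_lt_of_even {q s : ℕ} (hq : 2 ≤ q) (hs : 1 ≤ s) :
    2 * (2 * s) * (cosetReps q (q ^ s - 2 + 1)).card < q ^ (2 * s) - 1 := by
  have hqs : 2 ≤ q ^ s := hq.trans (Nat.le_self_pow (by omega) q)
  have hsq : q ^ (2 * s) = q ^ s * q ^ s := by rw [two_mul, pow_add]
  rw [card_cosetReps, hsq]
  rcases hq.eq_or_lt with rfl | hq3
  · have h := two_mul_le_pow le_rfl s
    have h2 : 2 ∣ 2 ^ s := dvd_pow_self 2 (by omega)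
    obtain ⟨y, hy⟩ := h2
    rw [hy] at h hqs ⊢
    have h3 : 2 * y - 2 - (2 * y - 2) / 2 = y - 1 := by omega
    rw [h3]
    obtain ⟨z, rfl⟩ := Nat.exists_eq_add_of_le' (show 1 ≤ y by omega)
    rw [Nat.add_sub_cancel, Nat.lt_sub_iff_add_lt]
    nlinarith
  · refine lt_of_le_of_lt (Nat.mul_le_mul_left _ (Nat.sub_le _ _)) ?_
    obtain ⟨z, hz⟩ := Nat.exists_eq_add_of_le' hqs
    rcases hs.eq_or_lt with rfl | hs2
    · rw [hz, Nat.add_sub_cancel, Nat.lt_sub_iff_add_lt]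
      nlinarith [sq_nonneg ((z : ℤ))]
    · have h := four_mul_le_pow hq3 hs2
      rw [hz] at h ⊢
      rw [Nat.add_sub_cancel, Nat.lt_sub_iff_add_lt]
      nlinarith

/-- The small cases `s = 1` and `q = s = 2` have to be treated separately; in the latter the two
sides are `30` and `31`. -/
theorem card_lt_of_odd {q s : ℕ} (hq : 2 ≤ q) (hs : 1 ≤ s) :
    2 * (2 * s + 1) * (cosetReps q (q ^ (s + 1) - q + 1)).card < q ^ (2 * s + 1) - 1 := by
  have hqs : q ≤ q ^ s := Nat.le_self_pow (by omega) q
  obtain ⟨y, hy⟩ := Nat.exists_eq_add_of_le' (show 1 ≤ q ^ s by omega)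
  obtain ⟨a, rfl⟩ := Nat.exists_eq_add_of_le' hq
  have hcard : (cosetReps (a + 2) ((a + 2) ^ (s + 1) - (a + 2) + 1)).card = (a + 1) * y := by
    have h1 : (a + 2) ^ (s + 1) - (a + 2) = (a + 2) * y := by
      rw [pow_succ, hy, add_mul, one_mul, Nat.add_sub_cancel, mul_comm]
    rw [card_cosetReps, h1, Nat.mul_div_cancel_left _ (by omega)]
    have : (a + 2) * y = (a + 1) * y + y := by ring
    omega
  have hpow : (a + 2) ^ (2 * s + 1) = (y + 1) * (y + 1) * (a + 2) := by
    rw [pow_succ, two_mul, pow_add, hy]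
  rw [hcard, hpow, Nat.lt_sub_iff_add_lt]
  have hlarge : 2 * (2 * s + 1) * (a + 1) ≤ (y + 1) * (a + 2) →
      2 * (2 * s + 1) * ((a + 1) * y) + 1 < (y + 1) * (y + 1) * (a + 2) := by
    intro h
    nlinarith
  rcases (show s = 1 ∨ s = 2 ∨ 3 ≤ s by omega) with rfl | rfl | hs3
  · obtain rfl : y = a + 1 := by rw [pow_one] at hy; omega
    zify
    nlinarith [sq_nonneg ((a : ℤ) - 1), sq_nonneg (a : ℤ), mul_nonneg (Int.natCast_nonneg a)
      (sq_nonneg ((a : ℤ) - 1))]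
  · rcases a.eq_zero_or_pos with rfl | ha
    · obtain rfl : y = 3 := by omega
      norm_num
    · refine hlarge ?_
      rw [← hy]
      nlinarith [mul_pos ha ha]
  · refine hlarge ?_
    rw [← hy]
    rcases a.eq_zero_or_pos with rfl | ha
    · have h : 2 * s + 1 ≤ 2 ^ s := by
        clear * - hs3
        induction s, hs3 using Nat.le_induction with
        | base => norm_num
        | succ s hs ih => rw [pow_succ]; omega
      simp only [zero_add, mul_one]
      omega
    · have h : 2 * (2 * s + 1) ≤ (a + 2) ^ s := by
        refine le_trans ?_ (Nat.pow_le_pow_left (show 3 ≤ a + 2 by omega) s)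
        clear * - hs3
        induction s, hs3 using Nat.le_induction with
        | base => norm_num
        | succ s hs ih => rw [pow_succ]; omega
      exact Nat.mul_le_mul h (by omega)

theorem card_lt_of_hermite_even {q m : ℕ} (hq : 2 ≤ q) (hm : 2 ≤ m) (hme : Even m) :
    2 * m * (cosetReps (q ^ 2) (q ^ (m + 1) - q ^ 2 + 1)).card + 2 ≤ q ^ (2 * m) - 1 := by
  obtain ⟨s, rfl⟩ := Nat.exists_eq_add_of_le' hm
  obtain ⟨y, hy⟩ := Nat.exists_eq_add_of_le' (show 1 ≤ q ^ (s + 1) from Nat.one_le_pow _ _ (by omega))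
  obtain ⟨b, hb⟩ := Nat.exists_eq_add_of_le' (show 1 ≤ q ^ 2 from Nat.one_le_pow _ _ (by omega))
  have h4 : 4 ≤ q ^ 2 := by nlinarith
  have hcard : (cosetReps (q ^ 2) (q ^ (s + 2 + 1) - q ^ 2 + 1)).card = b * y := by
    have h1 : q ^ (s + 2 + 1) - q ^ 2 = q ^ 2 * y := by
      rw [show s + 2 + 1 = s + 1 + 2 by ring, pow_add, hy, add_mul, one_mul, Nat.add_sub_cancel,
        mul_comm]
    rw [card_cosetReps, h1, Nat.mul_div_cancel_left _ (by omega), hb, add_mul, one_mul,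
      Nat.add_sub_cancel]
  have hpow : q ^ (2 * (s + 2)) = (y + 1) * (y + 1) * (b + 1) := by
    rw [← hb, ← hy, ← pow_add, ← pow_add]
    congr 1
    ring
  have h1 : 1 ≤ q ^ (2 * (s + 2)) := Nat.one_le_pow _ _ (by omega)
  suffices 2 * (s + 2) * (b * y) + 3 ≤ (y + 1) * (y + 1) * (b + 1) by
    rw [hcard, hpow]; omega
  rcases s.eq_zero_or_pos with rfl | hs
  · obtain rfl : q = y + 1 := by simpa using hy
    obtain rfl : b = y ^ 2 + 2 * y := by nlinarith
    have hy1 : 1 ≤ y := by omega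
    zify
    nlinarith [sq_nonneg ((y : ℤ) ^ 2 - 1)]
  · have hs2 : 2 ≤ s := by
      obtain ⟨t, ht⟩ := hme
      omega
    have h : 2 * (s + 2) ≤ y + 1 := by
      rw [← hy]
      refine le_trans ?_ (Nat.pow_le_pow_left hq (s + 1))
      clear * - hs2
      induction s, hs2 using Nat.le_induction with
      | base => norm_num
      | succ s hs ih => rw [pow_succ]; omega
    have h2 : 2 * (s + 2) * (b * y) ≤ (y + 1) * (b * y) := Nat.mul_le_mul_right _ h
    have h3 : 3 ≤ b := by omega
    nlinarith

theorem card_lt_of_hermite_odd {q m : ℕ} (hq : 2 ≤ q) (hm : 1 ≤ m) :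
    2 * m * (cosetReps (q ^ 2) (q ^ m - 2 + 1)).card + 2 ≤ q ^ (2 * m) - 1 := by
  have h := two_mul_le_pow hq m
  have hpow : q ^ (2 * m) = q ^ m * q ^ m := by rw [two_mul, pow_add]
  rw [card_cosetReps, hpow]
  obtain ⟨z, hz⟩ := Nat.exists_eq_add_of_le' (show 2 ≤ q ^ m from hq.trans
    (Nat.le_self_pow (by omega) q))
  have h2 : 2 * m * (z - z / q ^ 2) ≤ (z + 2) * z := by
    rw [hz] at h
    exact Nat.mul_le_mul h (Nat.sub_le _ _)
  rw [hz, Nat.add_sub_cancel]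
  have h3 : (z + 2) * (z + 2) = (z + 2) * z + 2 * z + 4 := by ring
  omega

theorem exists_eq_euclidDeltaMax {q m : ℕ} (hq : 2 ≤ q) (hm : 2 ≤ m) :
    ∃ T : ℕ, euclidDeltaMax q m = T + 1 ∧ T * (1 + q ^ (m / 2)) < q ^ m - 1 ∧
      2 * m * (cosetReps q (T + 1)).card < q ^ m - 1 := by
  obtain ⟨s, rfl | rfl⟩ := Nat.even_or_odd' m
  · have hqs : 2 ≤ q ^ s := hq.trans (Nat.le_self_pow (by omega) q)
    refine ⟨q ^ s - 2, ?_, ?_, card_lt_of_even hq (by omega)⟩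
    · have h1 : ⌈((2 * s : ℕ) : ℚ) / 2⌉₊ = s := by
        rw [Nat.cast_mul, Nat.cast_two, mul_div_cancel_left₀ _ two_ne_zero, Nat.ceil_natCast]
      have h2 : ¬ Odd (2 * s) := by simp
      rw [euclidDeltaMax, h1, if_neg h2]
      push_cast [hqs]
      ring
    · rw [Nat.mul_div_cancel_left _ two_pos, two_mul, pow_add]
      obtain ⟨z, hz⟩ := Nat.exists_eq_add_of_le' hqs
      rw [hz, Nat.add_sub_cancel, Nat.lt_sub_iff_add_lt]
      nlinarith
  · have hqs : q ≤ q ^ s := Nat.le_self_pow (by omega) q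
    have hqs' : q ≤ q ^ (s + 1) := Nat.le_self_pow (by omega) q
    refine ⟨q ^ (s + 1) - q, ?_, ?_, card_lt_of_odd hq (by omega)⟩
    · have h1 : ⌈((2 * s + 1 : ℕ) : ℚ) / 2⌉₊ = s + 1 := by
        rw [Nat.ceil_eq_iff (by omega)]
        push_cast
        constructor <;> linarith
      have h2 : Odd (2 * s + 1) := ⟨s, rfl⟩
      rw [euclidDeltaMax, h1, if_pos h2]
      push_cast [hqs']
      ring
    · rw [show (2 * s + 1) / 2 = s by omega]
      have h1 : q ^ (2 * s + 1) = q ^ (s + 1) * q ^ s := by rw [← pow_add]; congr 1; ring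
      have h2 : q ^ (s + 1) = q ^ s * q := pow_succ q s
      rw [h1]
      obtain ⟨z, hz⟩ := Nat.exists_eq_add_of_le' hqs'
      rw [hz] at h2 ⊢
      rw [Nat.add_sub_cancel, Nat.lt_sub_iff_add_lt]
      nlinarith

theorem exists_eq_hermiteDeltaMax {q m : ℕ} (hq : 2 ≤ q) (hm : 1 ≤ m) :
    ∃ T h : ℕ, hermiteDeltaMax q m = T + 1 ∧ T * (1 + q ^ h) < q ^ (2 * m) - 1 ∧
      (∀ l < m, 2 * l + 1 ≤ h ∨ 2 * m - (2 * l + 1) ≤ h) ∧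
      2 * m * (cosetReps (q ^ 2) (T + 1)).card + 2 ≤ q ^ (2 * m) - 1 := by
  by_cases hme : Even m
  · have hm2 : 2 ≤ m := by
      obtain ⟨t, ht⟩ := hme
      omega
    have hqm : q ^ 2 ≤ q ^ (m + 1) := Nat.pow_le_pow_right (by omega) (by omega)
    refine ⟨q ^ (m + 1) - q ^ 2, m - 1, ?_, ?_, ?_, card_lt_of_hermite_even hq hm2 hme⟩
    · rw [hermiteDeltaMax, if_pos hme, if_pos hme]
      push_cast [hqm]
      ring
    · have h1 : q ^ (2 * m) = q ^ (m + 1) * q ^ (m - 1) := by rw [← pow_add]; congr 1; omega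
      have h2 : q ^ (m + 1) = q ^ 2 * q ^ (m - 1) := by rw [← pow_add]; congr 1; omega
      have h4 : 4 ≤ q ^ 2 := by nlinarith
      rw [h1]
      obtain ⟨z, hz⟩ := Nat.exists_eq_add_of_le' hqm
      rw [hz] at h2 ⊢
      rw [Nat.add_sub_cancel, Nat.lt_sub_iff_add_lt]
      nlinarith
    · obtain ⟨t, rfl⟩ := hme
      intro l hl
      omega
  · have hqm : 2 ≤ q ^ m := hq.trans (Nat.le_self_pow (by omega) q)
    refine ⟨q ^ m - 2, m, ?_, ?_, ?_, card_lt_of_hermite_odd hq hm⟩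
    · rw [hermiteDeltaMax, if_neg hme, if_neg hme]
      push_cast [hqm]
      ring
    · rw [two_mul, pow_add]
      obtain ⟨z, hz⟩ := Nat.exists_eq_add_of_le' hqm
      rw [hz, Nat.add_sub_cancel, Nat.lt_sub_iff_add_lt]
      nlinarith
    · intro l hl
      omega

/-! ### Quantum BCH codes -/

theorem nonempty_ringHom_of_card_eq_sq {p : ℕ} [Fact p.Prime] {F K : Type*} [Field F] [Fintype F]
    [Algebra (ZMod p) F] [Field K] [Fintype K] {q : ℕ} (hF : Fintype.card F = q)
    (hK : Fintype.card K = q ^ 2) : Nonempty (F →+* K) := by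
  have hF' := FiniteField.pow_finrank_eq_card p F
  have hK' : Fintype.card K = p ^ (2 * finrank (ZMod p) F) := by
    rw [hK, ← hF, ← hF', ← pow_mul, mul_comm]
  have : CharP K p := charP_of_card_eq_prime_pow hK'
  let _ : Algebra (ZMod p) K := ZMod.algebra K p
  have h := FiniteField.pow_finrank_eq_card p K
  rw [hK'] at h
  have h' := Nat.pow_right_injective (Fact.out : p.Prime).two_le h
  obtain ⟨σ⟩ := FiniteField.nonempty_algHom_of_finrank_dvd (F := ZMod p) (K := F) (L := K)
    (h' ▸ Dvd.intro_left 2 rfl)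
  exact ⟨σ.toRingHom⟩

theorem mainTheorem4 {p : ℕ} [Fact p.Prime] {F : Type*} [Field F] [Fintype F] [DecidableEq F]
    [Algebra (ZMod p) F] (q : ℕ) (hq : Fintype.card F = q) :
    -- Euclidean case: `L` is the field with `q ^ m` elements, `α` a primitive element of it
    (∀ (m δ : ℕ), 2 ≤ m → 2 ≤ δ → (δ : ℤ) ≤ euclidDeltaMax q m →
      ∀ (L : Type*) [Field L] [Algebra F L] (α : L),
        Module.finrank F L = m → orderOf α = q ^ m - 1 →
      ∃ (k dQ : ℕ) (Q : Submodule ℂ (QuditSpace F (q ^ m - 1))),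
        (k : ℤ) = (q : ℤ) ^ m - 1 - 2 * m * ⌈((δ : ℚ) - 1) * (1 - 1 / (q : ℚ))⌉ ∧
        IsStabilizerCodeWith p Q k dQ ∧ δ ≤ dQ ∧ IsPureTo p Q δ ∧
        ∀ d : ℕ, CodeHasMinDist (bchCode F (q ^ m - 1) δ α) d → (d : ℤ) ≤ euclidDeltaMax q m →
          dQ = d ∧ IsPureTo p Q dQ) ∧
    -- Hermitian case: `K` is the field with `q ^ 2` elements, `L` the one with `q ^ (2 * m)`
    (∀ (m δ : ℕ), 1 ≤ m → 2 ≤ δ → (δ : ℤ) ≤ hermiteDeltaMax q m →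
      ∀ (K : Type*) [Field K] [Fintype K] [DecidableEq K] (L : Type*) [Field L] [Algebra K L]
        (α : L),
        Fintype.card K = q ^ 2 → Module.finrank K L = m → orderOf α = q ^ (2 * m) - 1 →
      ∃ (k dQ : ℕ) (Q : Submodule ℂ (QuditSpace F (q ^ (2 * m) - 1))),
        (k : ℤ) = (q : ℤ) ^ (2 * m) - 1 -
          2 * m * ⌈((δ : ℚ) - 1) * (1 - 1 / (q : ℚ) ^ 2)⌉ ∧
        IsStabilizerCodeWith p Q k dQ ∧ δ ≤ dQ ∧ IsPureTo p Q δ ∧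
        ∀ d : ℕ, CodeHasMinDist (bchCode K (q ^ (2 * m) - 1) δ α) d →
          (d : ℤ) < hermiteDeltaMax q m → dQ = d ∧ IsPureTo p Q dQ) := by
  have hq2 : 2 ≤ q := hq ▸ Fintype.one_lt_card
  refine ⟨fun m δ hm hδ hmax L _ _ α hL hα => ?_,
    fun m δ hm hδ hmax K _ _ _ L _ _ α hK hL hα => ?_⟩
  · have : FiniteDimensional F L := finite_of_finrank_pos (by omega)
    obtain ⟨T, hT, hmul, hcard⟩ := exists_eq_euclidDeltaMax hq2 hm
    rw [hT] at hmax ⊢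
    have hδT : δ ≤ T + 1 := by exact_mod_cast hmax
    have hmono := Nat.mul_le_mul_left (2 * m) (card_cosetReps_mono q hδT)
    obtain ⟨k, dQ, Q, hk, hQ, hd, hpure, hmin⟩ := exists_stabilizerCode_euclid (p := p) hL hα
      (by omega) hδT (fun z h1 h2 j hj l hl => hq.symm ▸
        not_dvd_mul_pow_add hq2 hmul h1 h2 hj hl (by omega)) (hq.symm ▸ hmono.trans_lt hcard)
    refine ⟨k, dQ, Q, ?_, hQ, hd, hpure, fun d hd' hdT => hmin d hd' (by exact_mod_cast hdT)⟩
    rw [hq] at hk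
    rw [ceil_eq_card_cosetReps (by omega) (by omega)]
    have hpow : 1 ≤ q ^ m := Nat.one_le_pow _ _ (by omega)
    zify [hpow] at hk
    linarith
  · have : FiniteDimensional K L := finite_of_finrank_pos (by omega)
    obtain ⟨σ⟩ := nonempty_ringHom_of_card_eq_sq (p := p) hq hK
    let _ : Algebra F K := σ.toAlgebra
    obtain ⟨T, h, hT, hmul, hexp, hcard⟩ := exists_eq_hermiteDeltaMax hq2 hm
    rw [hT] at hmax ⊢
    have hδT : δ ≤ T + 1 := by exact_mod_cast hmax
    have hmono := Nat.mul_le_mul_left (2 * m) (card_cosetReps_mono (q ^ 2) hδT)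
    obtain ⟨k, dQ, Q, hk, hQ, hd, hpure, hmin⟩ := exists_stabilizerCode_hermite (p := p) hq hK hL
      hα (by omega) hδT (fun z h1 h2 j hj l hl =>
        not_dvd_mul_pow_add hq2 hmul h1 h2 hj (by omega) (hexp l hl)) (by omega)
    refine ⟨k, dQ, Q, ?_, hQ, hd, hpure,
      fun d hd' hdT => hmin d hd' (by exact_mod_cast hdT.le)⟩
    rw [← Nat.cast_pow q 2, ceil_eq_card_cosetReps (by positivity) (by omega)]
    have hpow : 1 ≤ q ^ (2 * m) := Nat.one_le_pow _ _ (by omega)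
    zify [hpow] at hk
    linarith
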